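/- Conventions. A partial function $F:\subseteq\mathbb N^{\mathbb N}\to\mathbb N^{\mathbb N}$ is computable if a single oracle machine computes $n\mapsto F(p)(n)$ from the oracle $p$, for every $p\in\operatorname{dom}(F)$. A representation of a set $Y$ is a surjective partial map $\delta_Y:\subseteq\mathbb N^{\mathbb N}\to Y$; if $\delta_Y(p)=y$, then $p$ is called a name of $y$. A realizer of a partial multi-valued function $f:\subseteq Y\rightrightarrows Z$ between represented spaces is a partial function $F:\subseteq\mathbb N^{\mathbb N}\to\mathbb N^{\mathbb N}$ such that $\delta_ZF(p)\in f(\delta_Y(p))$ for every name $p$ of a point of $\operatorname{dom}(f)$. One writes $f\leq_{\mathrm{sW}}g$ if there are computable $K,H:\subseteq\mathbb N^{\mathbb N}\to\mathbb N^{\mathbb N}$ such that $H\circ G\circ K$ is a realizer of $f$ for every realizer $G$ of $g$, and $f\equiv_{\mathrm{sW}}g$ if $f\leq_{\mathrm{sW}}g$ and $g\leq_{\mathrm{sW}}f$. A computable Polish space is a complete metric space $(X,d)$ with a dense sequence $\alpha:\mathbb N\to X$ such that $(i,j)\mapsto d(\alpha(i),\alpha(j))$ is a computable double sequence of real numbers;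 it is perfect if it has no isolated points. Points of $X$ are represented by the Cauchy representation: $p$ is a name of $x$ if $\alpha(p(n))\to x$ and $d(\alpha(p(n)),\alpha(p(k)))<2^{-k}$ for all $n\geq k$. A number $n$ is represented by the sequences $p$ with $p(0)=n$, and a sequence by combining names of its members into one sequence by means of a pairing function. $\mathcal A_-(X)$ is the set of closed subsets of $X$ with negative information: with $(B_m)_m$ a standard enumeration of the open balls with center in the range of $\alpha$ and rational radius (an empty ball if the radius is not positive), $p$ is a name of $X\setminus\bigcup_iB_{p(i)}$. $\mathcal A_+(X)$ is the same set with positive information: $p$ is a name of $A$ if $p$ is a name of a sequence $(x_n)_n$ in $X\sqcup\{\infty\}$ such that $A$ is the closure in $X$ of $\{x_n:n\in\mathbb N\}\cap X$. Here $X\sqcup\{\infty\}$ is the coproduct of $X$ with one additional point $\infty$. Let $$\mathrm{BCT}_{0,X}:\subseteq\mathcal A_-(X)^{\mathbb N}\rightrightarrows X,\qquad \mathrm{BCT}_{2,X}:\subseteq\mathcal A_+(X)^{\mathbb N}\rightrightarrows X$$ be the problems whose domain consists of the sequences $(A_i)_i$ with $A_i^\circ=\emptyset$ for all $i$, and which map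 $(A_i)_i$ to $X\setminus\bigcup_iA_i$. Let $$\mathrm{BCT}_{1,X}:\subseteq\mathcal A_-(X)^{\mathbb N}\rightrightarrows\mathbb N,\qquad \mathrm{BCT}_{3,X}:\subseteq\mathcal A_+(X)^{\mathbb N}\rightrightarrows\mathbb N$$ be the problems whose domain consists of the sequences $(A_i)_i$ with $\bigcup_iA_i=X$, and which map $(A_i)_i$ to $\{i\in\mathbb N:A_i^\circ\neq\emptyset\}$. Baire space $\mathbb N^{\mathbb N}$ and Cantor space $2^{\mathbb N}$ carry the usual metric $d(x,y)=2^{-\min\{n:x(n)\neq y(n)\}}$ for $x\ne y$, with a standard enumeration of the sequences that are eventually $0$ as dense sequence. Theorem. For every computable perfect Polish space $X$ and every $i\in\{0,1,2,3\}$, $$\mathrm{BCT}_{i,X}\equiv_{\mathrm{sW}}\mathrm{BCT}_{i,\mathbb N^{\mathbb N}}.$$ In particular, $\mathrm{BCT}_{0,2^{\mathbb N}}\equiv_{\mathrm{sW}}\mathrm{BCT}_{0,\mathbb N^{\mathbb N}}$ and $\mathrm{BCT}_{2,2^{\mathbb N}}\equiv_{\mathrm{sW}}\mathrm{BCT}_{2,\mathbb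 N^{\mathbb N}}$. -/

import Mathlib

open Set Filter Topology

noncomputable section

namespace BCat

/-! ### Computability on Baire space -/

/-- Partial recursive functionals `Φ : ℕ^ℕ × ℕ ⇀ ℕ`, i.e. the functions `n ↦ Φ p n` computed by one
and the same oracle program for all oracles `p`. The clauses are those of the partial recursive
functions, together with a query to the oracle. -/
inductive RecFunctional : ((ℕ → ℕ) → ℕ →. ℕ) → Prop
  | zero : RecFunctional fun _ _ => Part.some 0
  | succ : RecFunctional fun _ n => Part.some (n + 1)
  | left : RecFunctional fun _ n => Part.some n.unpair.1
  | right : RecFunctional fun _ n => Part.some n.unpair.2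
  | oracle : RecFunctional fun p n => Part.some (p n)
  | pair {Φ Ψ : (ℕ → ℕ) → ℕ →. ℕ} : RecFunctional Φ → RecFunctional Ψ →
      RecFunctional fun p n => Nat.pair <$> Φ p n <*> Ψ p n
  | comp {Φ Ψ : (ℕ → ℕ) → ℕ →. ℕ} : RecFunctional Φ → RecFunctional Ψ →
      RecFunctional fun p n => Ψ p n >>= Φ p
  | prec {Φ Ψ : (ℕ → ℕ) → ℕ →. ℕ} : RecFunctional Φ → RecFunctional Ψ →
      RecFunctional fun p => Nat.unpaired fun a n =>
        n.rec (Φ p a) fun y IH => do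
          let i ← IH
          Ψ p (Nat.pair a (Nat.pair y i))
  | rfind {Φ : (ℕ → ℕ) → ℕ →. ℕ} : RecFunctional Φ →
      RecFunctional fun p a =>
        Nat.rfind fun n => (fun m => decide (m = 0)) <$> Φ p (Nat.pair a n)

/-- A partial function `F` on Baire space is computable if one oracle program computes, for
every `p` in the domain of `F`, the sequence `F p` from the oracle `p`. -/
def ComputableBaire (F : (ℕ → ℕ) →. (ℕ → ℕ)) : Prop :=
  ∃ Φ, RecFunctional Φ ∧ ∀ p, ∀ q ∈ F p, ∀ n, q n ∈ Φ p n

/-! ### Represented spaces, multi-valued functions, strong Weihrauch reducibility -/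

/-- A representation of `X`: a surjective partial map from Baire space onto `X`. -/
structure Representation (X : Type*) where
  toFun : (ℕ → ℕ) →. X
  surj : ∀ x, ∃ p, x ∈ toFun p

/-- A partial multi-valued function between two represented spaces. Only the values `val x` at
points `x ∈ dom` matter. -/
structure MultiFun {X Y : Type*} (δX : Representation X) (δY : Representation Y) where
  dom : Set X
  val : X → Set Y

/-- `F` realizes `f`: for every name `p` of a point `x` of the domain of `f`, the
value `F p` is defined and a name of a point of `f x`. -/
def IsRealizer {X Y : Type*} {δX : Representation X} {δY : Representation Y}
    (F : (ℕ → ℕ) →. (ℕ → ℕ)) (f : MultiFun δX δY) : Prop :=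
  ∀ p, ∀ x ∈ δX.toFun p, x ∈ f.dom → ∃ q ∈ F p, ∃ y ∈ δY.toFun q, y ∈ f.val x

/-- Strong Weihrauch reducibility: `H ∘ G ∘ K` realizes `f` for every realizer `G` of `g`. -/
def StrongReducible {X Y Z W : Type*} {δX : Representation X} {δY : Representation Y}
    {δZ : Representation Z} {δW : Representation W}
    (f : MultiFun δX δY) (g : MultiFun δZ δW) : Prop :=
  ∃ K H : (ℕ → ℕ) →. (ℕ → ℕ), ComputableBaire K ∧ ComputableBaire H ∧
    ∀ G : (ℕ → ℕ) →. (ℕ → ℕ), IsRealizer G g → IsRealizer (H.comp (G.comp K)) f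

/-- Strong Weihrauch equivalence. -/
def StrongEquiv {X Y Z W : Type*} {δX : Representation X} {δY : Representation Y}
    {δZ : Representation Z} {δW : Representation W}
    (f : MultiFun δX δY) (g : MultiFun δZ δW) : Prop :=
  StrongReducible f g ∧ StrongReducible g f

/-! ### Canonical representations -/

/-- The representation of `ℕ` for which `p` is a name of `p 0`. -/
def natRep : Representation ℕ where
  toFun p := Part.some (p 0)
  surj n := ⟨fun _ => n, Part.mem_some n⟩

/-- The representation of `X^ℕ`: `p` is a name of `(x_i)` if `j ↦ p ⟨i, j⟩` is a name of `x_i`,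
for every `i`. -/
def seqRep {X : Type*} (δ : Representation X) : Representation (ℕ → X) where
  toFun p := ⟨∀ i, (δ.toFun fun j => p (Nat.pair i j)).Dom, fun h i => (δ.toFun _).get (h i)⟩
  surj x := by
    choose p hp using fun i => δ.surj (x i)
    have hrow : ∀ i, (fun j => (fun n : ℕ => p n.unpair.1 n.unpair.2) (Nat.pair i j)) = p i := by
      intro i; funext j; simp
    refine ⟨fun n => p n.unpair.1 n.unpair.2, ?_⟩
    have h : ∀ i, x i ∈ δ.toFun fun j => (fun n : ℕ => p n.unpair.1 n.unpair.2) (Nat.pair i j) := by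
      intro i; rw [hrow i]; exact hp i
    exact ⟨fun i => (h i).1, funext fun i => (h i).2⟩

/-- The coproduct representation of `X ⊔ {∞}`, with `∞ = none`: a name of `x` is `0`
followed by a name of `x`, and every sequence that starts with a positive number is a name
of `∞`. -/
def optionRep {X : Type*} (δ : Representation X) : Representation (Option X) where
  toFun p := if p 0 = 0 then (δ.toFun fun n => p (n + 1)).map some else Part.some none
  surj x := by
    cases x with
    | none => exact ⟨fun _ => 1, by simp⟩
    | some x =>
      obtain ⟨p, hp⟩ := δ.surj x
      exact ⟨fun n => Nat.casesOn n 0 p, by simpa using hp⟩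

/-! ### Computable metric spaces -/

/-- A standard enumeration of the rational numbers: the index `⟨a, ⟨b, c⟩⟩` denotes
`(a - b) / (c + 1)`. -/
def rat (k : ℕ) : ℚ :=
  ((k.unpair.1 : ℚ) - (k.unpair.2.unpair.1 : ℚ)) / ((k.unpair.2.unpair.2 : ℚ) + 1)

theorem rat_pair (a b c : ℕ) : rat (Nat.pair a (Nat.pair b c)) = ((a : ℚ) - b) / ((c : ℚ) + 1) := by
  simp [rat]

theorem rat_surjective : Function.Surjective rat := by
  intro q
  refine ⟨Nat.pair q.num.toNat (Nat.pair (-q.num).toNat (q.den - 1)), ?_⟩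
  rw [rat_pair]
  have h1 : ((q.num.toNat : ℚ) - ((-q.num).toNat : ℚ)) = (q.num : ℚ) := by
    have : ((q.num.toNat : ℤ) - ((-q.num).toNat : ℤ)) = q.num := by omega
    exact_mod_cast this
  have h2 : (((q.den - 1 : ℕ) : ℚ) + 1) = (q.den : ℚ) := by
    have : q.den - 1 + 1 = q.den := Nat.sub_add_cancel q.den_pos
    exact_mod_cast this
  rw [h1, h2, Rat.num_div_den]

/-- A computable metric space `(X, d, α)`: the sequence `α` is dense in `X` and the map
`(i, j) ↦ d (α i) (α j)` is a computable double sequence of real numbers, i.e. rational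
approximations with error at most `2⁻ᵏ` can be computed from `i`, `j`, `k`. (Together with
`CompleteSpace X` this is a computable Polish space.) -/
structure ComputableMetric (X : Type*) [MetricSpace X] where
  α : ℕ → X
  dense : DenseRange α
  dist_computable : ∃ f : ℕ × ℕ × ℕ → ℕ, Computable f ∧
    ∀ i j k, |dist (α i) (α j) - (rat (f (i, j, k)) : ℝ)| ≤ (1 / 2 : ℝ) ^ k

namespace ComputableMetric

variable {X : Type*} [MetricSpace X] (C : ComputableMetric X)

/-- The Cauchy representation: `p` is a name of `lim α (p n)`, if the limit exists and the
convergence is such that `d (α (p n)) (α (p k)) < 2⁻ᵏ` for all `n ≥ k`. -/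
def cauchyRep : Representation X where
  toFun p := ⟨(∃ x, Tendsto (fun n => C.α (p n)) atTop (𝓝 x)) ∧
      ∀ k n, k ≤ n → dist (C.α (p n)) (C.α (p k)) < (1 / 2 : ℝ) ^ k,
    fun h => h.1.choose⟩
  surj x := by
    have hpos : ∀ n : ℕ, (0 : ℝ) < (1 / 2 : ℝ) ^ (n + 2) := fun n => by positivity
    choose p hp using fun n : ℕ => C.dense.exists_dist_lt x (hpos n)
    have hlim : Tendsto (fun n => C.α (p n)) atTop (𝓝 x) := by
      rw [tendsto_iff_dist_tendsto_zero]
      refine squeeze_zero (fun _ => dist_nonneg) (fun n => ?_)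
        (tendsto_pow_atTop_nhds_zero_of_lt_one (r := (1 / 2 : ℝ)) (by norm_num) (by norm_num))
      rw [dist_comm]
      refine (hp n).le.trans ?_
      exact pow_le_pow_of_le_one (by norm_num) (by norm_num) (by omega)
    have hfast : ∀ k n, k ≤ n → dist (C.α (p n)) (C.α (p k)) < (1 / 2 : ℝ) ^ k := by
      intro k n hkn
      have h1 := hp n
      have h2 := hp k
      have h3 : (1 / 2 : ℝ) ^ (n + 2) ≤ (1 / 2 : ℝ) ^ (k + 2) :=
        pow_le_pow_of_le_one (by norm_num) (by norm_num) (by omega)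
      have h4 : (1 / 2 : ℝ) ^ (k + 2) = (1 / 2 : ℝ) ^ k / 4 := by rw [pow_add]; ring
      have h5 : (0 : ℝ) < (1 / 2 : ℝ) ^ k := by positivity
      have h6 := dist_triangle_left (C.α (p n)) (C.α (p k)) x
      linarith
    refine ⟨p, ⟨⟨x, hlim⟩, hfast⟩, ?_⟩
    exact tendsto_nhds_unique (Exists.choose_spec (⟨x, hlim⟩ : ∃ x, Tendsto _ _ (𝓝 x))) hlim

/-- The standard enumeration of the rational open balls: the index `⟨n, k⟩` denotes the ball with
center `α n` whose radius is the `k`-th rational number (empty if the radius is not positive). -/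
def ratBall (m : ℕ) : Set X := Metric.ball (C.α m.unpair.1) (rat m.unpair.2 : ℝ)

/-- The negative information representation `ψ₋` of the closed subsets: `p` is a name of the
complement of `⋃ i, B_{p i}`. -/
def negRep : Representation (TopologicalSpace.Closeds X) where
  toFun p := Part.some
    ⟨(⋃ i, C.ratBall (p i))ᶜ, (isOpen_iUnion fun _ => Metric.isOpen_ball).isClosed_compl⟩
  surj A := by
    let S : Set ℕ := {m | C.ratBall m ⊆ (A : Set X)ᶜ}
    have hS : S.Nonempty := by
      obtain ⟨k, hk⟩ := rat_surjective 0
      refine ⟨Nat.pair 0 k, ?_⟩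
      simp [S, ratBall, hk]
    obtain ⟨p, hp⟩ := S.to_countable.exists_eq_range hS
    refine ⟨p, ?_⟩
    rw [Part.mem_some_iff]
    apply TopologicalSpace.Closeds.ext
    show (A : Set X) = (⋃ i, C.ratBall (p i))ᶜ
    rw [eq_compl_comm]
    apply Subset.antisymm
    · refine iUnion_subset fun i => ?_
      have : p i ∈ S := hp ▸ mem_range_self i
      exact this
    · intro x hx
      obtain ⟨ε, hε, hball⟩ := Metric.isOpen_iff.1 A.isClosed.isOpen_compl x hx
      obtain ⟨r, hr0, hr⟩ := exists_rat_btwn (half_pos hε)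
      obtain ⟨n, hn⟩ := C.dense.exists_dist_lt x hr0
      obtain ⟨k, rfl⟩ := rat_surjective r
      have hm : Nat.pair n k ∈ S := by
        intro y hy
        apply hball
        simp only [ratBall, Nat.unpair_pair, Metric.mem_ball] at hy ⊢
        have := dist_triangle y (C.α n) x
        rw [dist_comm (C.α n) x] at this
        linarith
      rw [hp] at hm
      obtain ⟨i, hi⟩ := hm
      refine mem_iUnion.2 ⟨i, ?_⟩
      rw [hi]
      simpa [ratBall] using hn

/-- The positive information representation `ψ₊` of the closed subsets: `p` is a name of the
closure in `X` of the points of `X` that occur in the sequence in `X ⊔ {∞}` with name `p`. -/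
def posRep : Representation (TopologicalSpace.Closeds X) where
  toFun p := ((seqRep (optionRep C.cauchyRep)).toFun p).map fun s =>
    ⟨closure {x | ∃ n, s n = some x}, isClosed_closure⟩
  surj A := by
    suffices h : ∃ s : ℕ → Option X, closure {x | ∃ n, s n = some x} = (A : Set X) by
      obtain ⟨s, hs⟩ := h
      obtain ⟨p, hp⟩ := (seqRep (optionRep C.cauchyRep)).surj s
      exact ⟨p, (Part.mem_map_iff _).2 ⟨s, hp, TopologicalSpace.Closeds.ext hs⟩⟩
    have : TopologicalSpace.SeparableSpace X := ⟨range C.α, countable_range _, C.dense⟩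
    have := UniformSpace.secondCountable_of_separable X
    rcases (A : Set X).eq_empty_or_nonempty with hA | hA
    · exact ⟨fun _ => none, by simp [hA]⟩
    · have := hA.to_subtype
      obtain ⟨u, hu⟩ := TopologicalSpace.exists_dense_seq (A : Set X)
      refine ⟨fun n => some (u n), ?_⟩
      have hset : {x : X | ∃ n, some (u n : X) = some x} = Subtype.val '' range u := by
        ext x; simp
      rw [hset]
      apply Subset.antisymm
      · refine closure_minimal ?_ A.isClosed
        rintro _ ⟨y, -, rfl⟩
        exact y.2
      · intro x hx
        exact image_closure_subset_closure_image continuous_subtype_val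
          ⟨⟨x, hx⟩, hu ⟨x, hx⟩, rfl⟩

/-! ### The four versions of the Baire Category Theorem -/

/-- `BCT₀`: given negative information on nowhere dense closed sets `A_i`, find a point that
belongs to none of them. -/
def BCT0 : MultiFun (seqRep C.negRep) C.cauchyRep where
  dom := {A | ∀ i, interior (A i : Set X) = ∅}
  val A := (⋃ i, (A i : Set X))ᶜ

/-- `BCT₁`: given negative information on closed sets `A_i` that cover `X`, find an index `i` such
that `A_i` is somewhere dense. -/
def BCT1 : MultiFun (seqRep C.negRep) natRep where
  dom := {A | ⋃ i, (A i : Set X) = univ}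
  val A := {i | interior (A i : Set X) ≠ ∅}

/-- `BCT₂`: as `BCT₀`, with positive information on the closed sets. -/
def BCT2 : MultiFun (seqRep C.posRep) C.cauchyRep where
  dom := {A | ∀ i, interior (A i : Set X) = ∅}
  val A := (⋃ i, (A i : Set X))ᶜ

/-- `BCT₃`: as `BCT₁`, with positive information on the closed sets. -/
def BCT3 : MultiFun (seqRep C.posRep) natRep where
  dom := {A | ⋃ i, (A i : Set X) = univ}
  val A := {i | interior (A i : Set X) ≠ ∅}

end ComputableMetric

/-! ### Baire space and Cantor space as computable metric spaces -/

/-- The space `E^ℕ` of sequences, with the metric `d(x, y) = 2⁻ⁿ` for `x ≠ y`, where `n` is the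
least index with `x n ≠ y n`. Baire space is `SeqSpace ℕ`, Cantor space is `SeqSpace Bool`. -/
def SeqSpace (E : Type) : Type := ℕ → E

instance (E : Type) [TopologicalSpace E] [DiscreteTopology E] : MetricSpace (SeqSpace E) :=
  PiNat.metricSpace (E := fun _ => E)

namespace SeqSpace

/-- The `n`-th eventually constant sequence: the `n`-th list followed by the default value. -/
def point (E : Type) [Primcodable E] [Inhabited E] (n : ℕ) : SeqSpace E :=
  fun i => ((Encodable.decode n : Option (List E)).getD []).getD i default

variable (E : Type) [TopologicalSpace E] [DiscreteTopology E]

theorem dist_le_iff (x y : SeqSpace E) (n : ℕ) :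
    dist x y ≤ (1 / 2 : ℝ) ^ n ↔ ∀ i < n, x i = y i :=
  (PiNat.mem_cylinder_iff_dist_le (E := fun _ => E) (x := y) (y := x) (n := n)).symm.trans
    PiNat.mem_cylinder_iff

theorem dist_eq_of_first {x y : SeqSpace E} {n : ℕ} (h : ∀ i < n, x i = y i) (hn : x n ≠ y n) :
    dist x y = (1 / 2 : ℝ) ^ n := by
  have hne : x ≠ y := fun h => hn (congrFun h n)
  have h1 : dist x y = (1 / 2 : ℝ) ^ PiNat.firstDiff (E := fun _ => E) x y :=
    PiNat.dist_eq_of_ne (E := fun _ => E) hne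
  have h2 : n ≤ PiNat.firstDiff (E := fun _ => E) x y := by
    by_contra hlt
    exact PiNat.apply_firstDiff_ne (E := fun _ => E) hne (h _ (not_le.1 hlt))
  have h3 : PiNat.firstDiff (E := fun _ => E) x y ≤ n := by
    by_contra hlt
    exact hn (PiNat.apply_eq_of_lt_firstDiff (E := fun _ => E) (not_le.1 hlt))
  rw [h1, le_antisymm h3 h2]

variable [Primcodable E] [Inhabited E] [DecidableEq E]

/-- `SeqSpace E` as a computable metric space, with the eventually constant sequences `point` as
dense sequence. -/
def computableMetric : ComputableMetric (SeqSpace E) where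
  α := point E
  dense := by
    refine Metric.denseRange_iff.2 fun x r hr => ?_
    obtain ⟨n, hn⟩ := exists_pow_lt_of_lt_one hr (by norm_num : (1 / 2 : ℝ) < 1)
    refine ⟨Encodable.encode ((List.range n).map x), lt_of_le_of_lt ?_ hn⟩
    rw [dist_le_iff]
    intro i hi
    have h : (List.range n).map x = (List.range n).map fun j => x j := rfl
    rw [h]
    simp [point, hi]
  dist_computable := by
    let m : ℕ × ℕ × ℕ → ℕ := fun t =>
      (List.range (t.2.2 + 1)).findIdx fun n => !(decide (point E t.1 n = point E t.2.1 n))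
    have hpt : Primrec₂ (fun i n : ℕ => point E i n) := by
      have h1 : Primrec fun q : ℕ × ℕ => (Encodable.decode q.1 : Option (List E)).getD [] :=
        Primrec.option_getD.comp (Primrec.decode.comp Primrec.fst) (Primrec.const [])
      exact (Primrec.list_getD (default : E)).comp h1 Primrec.snd
    have hm : Primrec m := by
      refine Primrec.list_findIdx
        (Primrec.list_range.comp (Primrec.succ.comp (Primrec.snd.comp Primrec.snd))) ?_
      refine Primrec.not.comp (Primrec.eq.decide.comp
        (hpt.comp (Primrec.fst.comp Primrec.fst) Primrec.snd)
        (hpt.comp (Primrec.fst.comp (Primrec.snd.comp Primrec.fst)) Primrec.snd))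
    refine ⟨fun t => Nat.pair 1 (Nat.pair 0 (2 ^ m t - 1)), ?_, fun i j k => ?_⟩
    · have hpow : Primrec fun n : ℕ => 2 ^ n := by
        refine (Primrec.nat_rec₁ (f := fun _ r : ℕ => r * 2) 1
          (Primrec.nat_mul.comp Primrec.snd (Primrec.const 2))).of_eq fun n => ?_
        induction n with
        | zero => rfl
        | succ n ih => rw [pow_succ, ← ih]
      exact (Primrec₂.natPair.comp (Primrec.const 1) (Primrec₂.natPair.comp (Primrec.const 0)
        (Primrec.nat_sub.comp (hpow.comp hm) (Primrec.const 1)))).to_comp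
    · have hr : (rat (Nat.pair 1 (Nat.pair 0 (2 ^ m (i, j, k) - 1))) : ℝ)
          = (1 / 2 : ℝ) ^ m (i, j, k) := by
        have h2 : ((2 ^ m (i, j, k) - 1 : ℕ) : ℚ) + 1 = 2 ^ m (i, j, k) := by
          have : 2 ^ m (i, j, k) - 1 + 1 = 2 ^ m (i, j, k) := Nat.sub_add_cancel Nat.one_le_two_pow
          exact_mod_cast this
        rw [rat_pair, h2]
        push_cast
        simp
      rw [hr]
      have hlt : ∀ n < m (i, j, k), point E i n = point E j n := by
        intro n hn
        have := List.not_of_lt_findIdx hn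
        simpa using this
      have hle : m (i, j, k) ≤ k + 1 := by
        simpa using List.findIdx_le_length (xs := List.range (k + 1))
          (p := fun n => !(decide (point E i n = point E j n)))
      rcases hle.lt_or_eq with hk | hk
      · have hne : point E i (m (i, j, k)) ≠ point E j (m (i, j, k)) := by
          have := List.findIdx_getElem (xs := List.range (k + 1))
            (p := fun n => !(decide (point E i n = point E j n))) (w := by simpa using hk)
          simpa using this
        rw [dist_eq_of_first E hlt hne]
        simp
      · have h0 := (dist_le_iff E (point E i) (point E j) _).2 hlt
        have h1 : (1 / 2 : ℝ) ^ m (i, j, k) ≤ (1 / 2 : ℝ) ^ k :=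
          pow_le_pow_of_le_one (by norm_num) (by norm_num) (by omega)
        have h2 : (0 : ℝ) ≤ dist (point E i) (point E j) := dist_nonneg
        rw [abs_le]
        constructor <;> linarith

end SeqSpace

/-- Baire space `ℕ^ℕ` as a computable metric space. -/
def baire : ComputableMetric (SeqSpace ℕ) := SeqSpace.computableMetric ℕ

/-- Cantor space `2^ℕ` as a computable metric space. -/
def cantor : ComputableMetric (SeqSpace Bool) := SeqSpace.computableMetric Bool

end BCat

end

/-!
The Baire category problems of a perfect computable Polish space and of Baire space are compared by
means of computable *systems* (`System`): decreasing families `U s` of open sets, indexed by finite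
sequences of natural numbers, with diameters that tend to zero, with a computable point in each
set, and with a computable test that lists the rational balls well inside of each set.

All reductions are instances of one theorem, `System.strongReducible`. Let `X` carry a system that
is a *source* (each point of `U s` lies in a child of `U s`, and each branch has a
point in its intersection), and let a perfect space `Y` carry a system `V` that is a *target*
(siblings are disjoint, and the children of `V s` contain all members of the dense sequence that lie
in `V s`). All `y` in a comeager subset of `Y` lie on a unique branch, and a Cauchy name of a point
on that branch of `X` can be computed from `y`. A closed set `A` in `X` is replaced by a closed set `B` in
`Y` that contains the points `y` whose branch belongs to a point of `A`, that also contains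
the complement of the `i`-th level of `V`, and that is nowhere dense if `A` is
(`System.Transfers`). A point of `Y` outside of all the sets `B` has a branch, and the point of `X`
on it is outside of all the sets `A`. If the sets `A` cover `X`, then the sets `B` cover `Y`, and
an index `i` such that `B i` is somewhere dense is correct for `A i` too; so the answer needs no
translation, as strong reducibility demands.

* With negative information, `V s` is removed from `Y` whenever `U s` is seen to be contained in a
  removed ball of `X` and `s` has length at least `i` (`System.exists_transfers_neg`).
* With positive information, the chosen point of `V s` is enumerated whenever `U s` contains one of
  the given points. The complement of the `i`-th level, of which only negative information is
  available, is covered by enumerating in addition the chosen points of those `V s` that are not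
  seen to have a large distance from it, in comparison with `2 ^ -|s|`. If `A` is nowhere dense,
  then every nonempty open set contains a smaller one in which only finitely many points are
  enumerated, and `B` is nowhere dense as `Y` has no isolated points (`System.transfers_pos`).

Baire space carries the system of the cylinders, both a source and a target (`cylinders`). A
complete space carries a source of nested balls (`balls`), which gives the reductions to Baire
space. A perfect space carries a target (`splitSystem`), which gives the reductions from Baire
space: a region is split again and again by a small sphere around the first member of the dense
sequence in it. The radii of the spheres are chosen such that no member of the dense sequence is on
any of them, which makes it decidable on which side these points are.
-/

noncomputable section

namespace BCat

/-! ### Closure properties of computable functions -/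

attribute [fun_prop] Computable

section ComputableClosure

variable {α β γ σ : Type*} [Primcodable α] [Primcodable β] [Primcodable γ] [Primcodable σ]

@[fun_prop] theorem computable_id' : Computable fun a : α => a := Computable.id

@[fun_prop] theorem computable_const' (s : σ) : Computable fun _ : α => s := Computable.const s

@[fun_prop] theorem computable_comp' {f : β → σ} {g : α → β} (hf : Computable f)
    (hg : Computable g) : Computable fun a => f (g a) := hf.comp hg

@[fun_prop] theorem computable_mk {f : α → β} {g : α → γ} (hf : Computable f)
    (hg : Computable g) : Computable fun a => (f a, g a) := hf.pair hg

@[fun_prop] theorem computable_fst {f : α → β × γ} (hf : Computable f) :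
    Computable fun a => (f a).1 := Computable.fst.comp hf

@[fun_prop] theorem computable_snd {f : α → β × γ} (hf : Computable f) :
    Computable fun a => (f a).2 := Computable.snd.comp hf

@[fun_prop] theorem computable_unpair {f : α → ℕ} (hf : Computable f) :
    Computable fun a => (f a).unpair := Computable.unpair.comp hf

@[fun_prop] theorem computable_natPair {f g : α → ℕ} (hf : Computable f) (hg : Computable g) :
    Computable fun a => Nat.pair (f a) (g a) := Primrec₂.natPair.to_comp.comp hf hg

@[fun_prop] theorem computable_add {f g : α → ℕ} (hf : Computable f) (hg : Computable g) :
    Computable fun a => f a + g a := Primrec.nat_add.to_comp.comp hf hg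

@[fun_prop] theorem computable_mul {f g : α → ℕ} (hf : Computable f) (hg : Computable g) :
    Computable fun a => f a * g a := Primrec.nat_mul.to_comp.comp hf hg

@[fun_prop] theorem computable_sub {f g : α → ℕ} (hf : Computable f) (hg : Computable g) :
    Computable fun a => f a - g a := Primrec.nat_sub.to_comp.comp hf hg

@[fun_prop] theorem computable_div {f g : α → ℕ} (hf : Computable f) (hg : Computable g) :
    Computable fun a => f a / g a := Primrec.nat_div.to_comp.comp hf hg

@[fun_prop] theorem computable_two_pow {f : α → ℕ} (hf : Computable f) :
    Computable fun a => 2 ^ f a := by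
  have h : Primrec fun n : ℕ => 2 ^ n := by
    refine (Primrec.nat_rec₁ (f := fun _ r : ℕ => r * 2) 1
      (Primrec.nat_mul.comp Primrec.snd (Primrec.const 2))).of_eq fun n => ?_
    induction n with
    | zero => rfl
    | succ n ih => rw [pow_succ, ← ih]
  exact h.to_comp.comp hf

@[fun_prop] theorem computable_ble {f g : α → ℕ} (hf : Computable f) (hg : Computable g) :
    Computable fun a => Nat.ble (f a) (g a) :=
  (Primrec.nat_le.decide.to_comp.comp hf hg).of_eq fun a => by
    rw [Bool.eq_iff_iff]
    simp

@[fun_prop] theorem computable_decide_eq [DecidableEq β] {f g : α → β} (hf : Computable f)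
    (hg : Computable g) : Computable fun a => decide (f a = g a) :=
  Primrec.eq.decide.to_comp.comp hf hg

@[fun_prop] theorem computable_not {f : α → Bool} (hf : Computable f) :
    Computable fun a => !f a := Primrec.not.to_comp.comp hf

@[fun_prop] theorem computable_and {f g : α → Bool} (hf : Computable f) (hg : Computable g) :
    Computable fun a => f a && g a := Primrec.and.to_comp.comp hf hg

@[fun_prop] theorem computable_or {f g : α → Bool} (hf : Computable f) (hg : Computable g) :
    Computable fun a => f a || g a := Primrec.or.to_comp.comp hf hg

@[fun_prop] theorem computable_ite {p : α → Bool} {f g : α → β} (hp : Computable p)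
    (hf : Computable f) (hg : Computable g) :
    Computable fun a => if p a = true then f a else g a :=
  (Computable.cond hp hf hg).of_eq fun a => by cases h : p a <;> simp

@[fun_prop] theorem computable_length {f : α → List β} (hf : Computable f) :
    Computable fun a => (f a).length := Computable.list_length.comp hf

@[fun_prop] theorem computable_cons {f : α → β} {g : α → List β} (hf : Computable f)
    (hg : Computable g) : Computable fun a => f a :: g a := Computable.list_cons.comp hf hg

@[fun_prop] theorem computable_take {f : α → ℕ} {g : α → List β} (hf : Computable f)
    (hg : Computable g) : Computable fun a => (g a).take (f a) :=
  Primrec.list_take.to_comp.comp hf hg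

/-- Folding a list is computable, as a recursion on the length of the list. -/
theorem computable_foldl {f : α → List β} {g : α → σ} {h : α → σ → β → σ}
    (hf : Computable f) (hg : Computable g)
    (hh : Computable fun t : α × σ × β => h t.1 t.2.1 t.2.2) :
    Computable fun a => (f a).foldl (h a) (g a) := by
  have h2 : Computable₂ fun (a : α) (t : ℕ × σ) =>
      Option.casesOn (motive := fun _ => σ) ((f a)[t.1]?) t.2 fun b => h a t.2 b := by
    refine Computable.option_casesOn (Computable.list_getElem?.comp ?_ ?_) ?_ ?_
    · exact hf.comp Computable.fst
    · exact Computable.fst.comp Computable.snd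
    · exact Computable.snd.comp Computable.snd
    · exact hh.comp (((Computable.fst.comp Computable.fst).pair
        ((Computable.snd.comp (Computable.snd.comp Computable.fst)).pair Computable.snd)))
  refine (Computable.nat_rec (Computable.list_length.comp hf) hg h2).of_eq fun a => ?_
  have key : ∀ n, n ≤ (f a).length →
      Nat.rec (motive := fun _ => σ) (g a) (fun y IH =>
        Option.casesOn (motive := fun _ => σ) ((f a)[y]?) IH fun b => h a IH b) n
        = ((f a).take n).foldl (h a) (g a) := by
    intro n
    induction n with
    | zero => intro _; simp
    | succ n ih =>
      intro hn
      have hlt : n < (f a).length := hn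
      have h1 := ih (le_of_lt hlt)
      rw [List.take_add_one, List.foldl_append, ← h1]
      simp [List.getElem?_eq_getElem hlt]
  simpa using key _ le_rfl

theorem computable_all {f : α → List β} {g : α → β → Bool} (hf : Computable f)
    (hg : Computable fun t : α × β => g t.1 t.2) : Computable fun a => (f a).all (g a) := by
  refine (computable_foldl (g := fun _ => true) (h := fun a b x => b && g a x) hf
    (Computable.const true) (by fun_prop)).of_eq fun a => ?_
  have key : ∀ (l : List β) (b : Bool),
      l.foldl (fun b x => b && g a x) b = (b && l.all (g a)) := by
    intro l
    induction l with
    | nil => simp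
    | cons x l ih => intro b; simp [ih, Bool.and_assoc]
  simpa using key (f a) true

theorem computable_iterate {f : α → σ} {n : α → ℕ} {g : σ → σ} (hf : Computable f)
    (hn : Computable n) (hg : Computable g) : Computable fun a => g^[n a] (f a) := by
  refine (Computable.nat_rec (h := fun _ t => g t.2) hn hf
    (hg.comp (Computable.snd.comp Computable.snd))).of_eq fun a => ?_
  generalize n a = k
  induction k with
  | zero => rfl
  | succ k ih => rw [Function.iterate_succ_apply', ← ih]

/-- Unbounded search for the least number that passes a computable test. -/
theorem computable_find {P : α → ℕ → Bool} (hP : Computable fun t : α × ℕ => P t.1 t.2)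
    (h : ∀ a, ∃ n, P a n = true) : Computable fun a => Nat.find (h a) :=
  Computable.find (P := fun a n => P a n = true)
    ⟨fun t => inferInstance, hP.of_eq fun t => by simp⟩ h

end ComputableClosure

/-- The list with a given code. -/
def listOf (a : ℕ) : List ℕ := (Encodable.decode a).getD []

@[simp] theorem listOf_encode (s : List ℕ) : listOf (Encodable.encode s) = s := by
  simp [listOf]

@[fun_prop] theorem computable_listOf : Computable listOf :=
  (Primrec.option_getD.comp Primrec.decode (Primrec.const [])).to_comp

/-! ### Computable functions on Baire space -/

namespace RecFunctional

theorem of_eq {Φ Ψ : (ℕ → ℕ) → ℕ →. ℕ} (h : RecFunctional Φ) (H : ∀ p n, Φ p n = Ψ p n) :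
    RecFunctional Ψ := by
  have : Φ = Ψ := funext fun p => funext fun n => H p n
  exact this ▸ h

theorem of_partrec {f : ℕ →. ℕ} (hf : Nat.Partrec f) : RecFunctional fun _ => f := by
  induction hf with
  | zero => exact zero
  | succ => exact succ
  | left => exact left
  | right => exact right
  | pair _ _ h1 h2 => exact pair h1 h2
  | comp _ _ h1 h2 => exact comp h1 h2
  | prec _ _ h1 h2 => exact prec h1 h2
  | rfind _ h1 => exact rfind h1

theorem of_computable {f : ℕ → ℕ} (hf : Computable f) :
    RecFunctional fun _ n => Part.some (f n) :=
  of_partrec (Partrec.nat_iff.1 hf)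

theorem comp_total {f g : (ℕ → ℕ) → ℕ → ℕ} (hf : RecFunctional fun p n => Part.some (f p n))
    (hg : RecFunctional fun p n => Part.some (g p n)) :
    RecFunctional fun p n => Part.some (f p (g p n)) :=
  (comp hf hg).of_eq fun p n => by simp

theorem pair_total {f g : (ℕ → ℕ) → ℕ → ℕ} (hf : RecFunctional fun p n => Part.some (f p n))
    (hg : RecFunctional fun p n => Part.some (g p n)) :
    RecFunctional fun p n => Part.some (Nat.pair (f p n) (g p n)) :=
  (pair hf hg).of_eq fun p n => by simp [Seq.seq]

/-- A function that makes two oracle queries, at places computed from the input, and computes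
its value from the input and the two answers. -/
theorem of_two_queries {ψ : ℕ × ℕ × ℕ → ℕ} {u v : ℕ → ℕ} (hψ : Computable ψ)
    (hu : Computable u) (hv : Computable v) :
    RecFunctional fun p n => Part.some (ψ (n, p (u n), p (v n))) := by
  have h1 : RecFunctional fun p n => Part.some (p (u n)) := comp_total oracle (of_computable hu)
  have h2 : RecFunctional fun p n => Part.some (p (v n)) := comp_total oracle (of_computable hv)
  have h3 : RecFunctional fun _ n => Part.some n := of_computable Computable.id
  have h4 : Computable fun n : ℕ =>
      ψ (n.unpair.1, n.unpair.2.unpair.1, n.unpair.2.unpair.2) := by fun_prop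
  exact (comp_total (of_computable h4) (pair_total h3 (pair_total h1 h2))).of_eq
    fun p n => by simp

end RecFunctional

theorem ComputableBaire.of_two_queries {ψ : ℕ × ℕ × ℕ → ℕ} {u v : ℕ → ℕ} (hψ : Computable ψ)
    (hu : Computable u) (hv : Computable v) :
    ComputableBaire fun p => Part.some fun n => ψ (n, p (u n), p (v n)) := by
  refine ⟨_, RecFunctional.of_two_queries hψ hu hv, fun p q hq n => ?_⟩
  rw [Part.mem_some_iff] at hq
  simp [hq]

theorem ComputableBaire.id : ComputableBaire fun p => Part.some p :=
  ComputableBaire.of_two_queries (ψ := fun t => t.2.1) (u := fun n => n) (v := fun n => n)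
    (by fun_prop) (by fun_prop) (by fun_prop)

/-- The partial function on Baire space that searches, for each `n`, the least `w` such that the
test `P` accepts `n`, `w` and the answer of the oracle at `u w`, and returns `r w`. -/
def searchFun (P : ℕ × ℕ × ℕ → Bool) (u r : ℕ → ℕ) : (ℕ → ℕ) →. (ℕ → ℕ) := fun q =>
  ⟨∀ n, ∃ w, P (n, w, q (u w)) = true, fun h n => r (Nat.find (h n))⟩

theorem mem_searchFun {P : ℕ × ℕ × ℕ → Bool} {u r q z : ℕ → ℕ}
    (h : ∀ n, ∃ w, P (n, w, q (u w)) = true)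
    (hz : ∀ n w, P (n, w, q (u w)) = true → r w = z n) : z ∈ searchFun P u r q :=
  ⟨h, funext fun n => hz n _ (Nat.find_spec (h n))⟩

theorem ComputableBaire.searchFun {P : ℕ × ℕ × ℕ → Bool} {u r : ℕ → ℕ} (hP : Computable P)
    (hu : Computable u) (hr : Computable r) : ComputableBaire (searchFun P u r) := by
  have h1 := RecFunctional.of_two_queries
    (ψ := fun t => if P (t.1.unpair.1, t.1.unpair.2, t.2.1) = true then 0 else 1)
    (u := fun m => u m.unpair.2) (v := fun m => u m.unpair.2)
    (by fun_prop) (by fun_prop) (by fun_prop)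
  have h2 := RecFunctional.comp (RecFunctional.of_computable hr) (RecFunctional.rfind h1)
  refine ⟨_, h2, ?_⟩
  rintro q z ⟨h, rfl⟩ n
  refine Part.mem_bind_iff.2 ⟨Nat.find (h n), ?_, Part.mem_some _⟩
  refine Nat.mem_rfind.2 ⟨?_, fun {m} hm => ?_⟩
  · have := Nat.find_spec (h n)
    simp [this]
  · have := Nat.find_min (h n) hm
    simp [this]

/-! ### Integer approximations of distances -/

namespace ComputableMetric

variable {X : Type*} [MetricSpace X] (C : ComputableMetric X)

/-- An integer approximation of `2 ^ k * d (α i, α j)`, with error at most `2`. -/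
def approx (i j k : ℕ) : ℕ :=
  let r := C.dist_computable.choose (i, j, k)
  ((r.unpair.1 - r.unpair.2.unpair.1) * 2 ^ k) / (r.unpair.2.unpair.2 + 1)

theorem computable_approx : Computable fun t : ℕ × ℕ × ℕ => C.approx t.1 t.2.1 t.2.2 := by
  have := C.dist_computable.choose_spec.1
  unfold approx
  fun_prop

theorem abs_approx_sub_le (i j k : ℕ) :
    |(C.approx i j k : ℝ) - 2 ^ k * dist (C.α i) (C.α j)| ≤ 2 := by
  have h := C.dist_computable.choose_spec.2 i j k
  unfold approx
  simp only
  generalize C.dist_computable.choose (i, j, k) = r at h ⊢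
  unfold rat at h
  push_cast at h
  generalize r.unpair.1 = a at h ⊢
  generalize r.unpair.2.unpair.1 = b at h ⊢
  generalize r.unpair.2.unpair.2 = c at h ⊢
  generalize hd : dist (C.α i) (C.α j) = d at h ⊢
  have hd0 : 0 ≤ d := hd ▸ dist_nonneg
  have hP : (0 : ℝ) < 2 ^ k := by positivity
  have hpow : (1 / 2 : ℝ) ^ k * 2 ^ k = 1 := by rw [← mul_pow]; norm_num
  have hc : (0 : ℝ) < (c : ℝ) + 1 := by positivity
  rw [abs_le] at h
  have h1 : 2 ^ k * d - (((a : ℝ) - b) / (c + 1)) * 2 ^ k ≤ 1 := by nlinarith [h.2]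
  have h2 : -1 ≤ 2 ^ k * d - (((a : ℝ) - b) / (c + 1)) * 2 ^ k := by nlinarith [h.1]
  rcases le_total a b with hab | hab
  · have h0 : a - b = 0 := Nat.sub_eq_zero_of_le hab
    have h3 : ((a : ℝ) - b) / (c + 1) ≤ 0 :=
      div_nonpos_of_nonpos_of_nonneg (by simpa using hab) hc.le
    have h4 : (((a : ℝ) - b) / (c + 1)) * 2 ^ k ≤ 0 := mul_nonpos_of_nonpos_of_nonneg h3 hP.le
    rw [h0, abs_le]
    simp only [zero_mul, Nat.zero_div, Nat.cast_zero]
    constructor <;> nlinarith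
  · have h3 : ((((a - b) * 2 ^ k) / (c + 1) : ℕ) : ℝ) ≤ (((a : ℝ) - b) / (c + 1)) * 2 ^ k := by
      refine Nat.cast_div_le.trans (le_of_eq ?_)
      push_cast [Nat.cast_sub hab]
      ring
    have h4 : (((a : ℝ) - b) / (c + 1)) * 2 ^ k < ((((a - b) * 2 ^ k) / (c + 1) : ℕ) : ℝ) + 1 := by
      have := Nat.lt_div_mul_add (a := (a - b) * 2 ^ k) (b := c + 1) (Nat.succ_pos c)
      rw [← mul_div_right_comm, div_lt_iff₀ hc]
      have h5 : (((a - b) * 2 ^ k : ℕ) : ℝ) <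
          ((((a - b) * 2 ^ k) / (c + 1) * (c + 1) + (c + 1) : ℕ) : ℝ) := by exact_mod_cast this
      rw [Nat.cast_add, Nat.cast_mul, Nat.cast_mul _ (c + 1), Nat.cast_sub hab] at h5
      push_cast at h5 ⊢
      linarith
    rw [abs_le]
    constructor <;> linarith

theorem approx_le (i j k : ℕ) : (C.approx i j k : ℝ) ≤ 2 ^ k * dist (C.α i) (C.α j) + 2 := by
  have := (abs_le.1 (C.abs_approx_sub_le i j k)).2
  linarith

theorem le_approx (i j k : ℕ) : 2 ^ k * dist (C.α i) (C.α j) ≤ C.approx i j k + 2 := by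
  have := (abs_le.1 (C.abs_approx_sub_le i j k)).1
  linarith

theorem mem_cauchyRep {p : ℕ → ℕ} {x : X} : x ∈ C.cauchyRep.toFun p ↔
    Tendsto (fun n => C.α (p n)) atTop (𝓝 x) ∧
      ∀ k n, k ≤ n → dist (C.α (p n)) (C.α (p k)) < (1 / 2 : ℝ) ^ k := by
  constructor
  · rintro ⟨h, rfl⟩
    exact ⟨h.1.choose_spec, h.2⟩
  · rintro ⟨h1, h2⟩
    exact ⟨⟨⟨x, h1⟩, h2⟩, tendsto_nhds_unique
      (Exists.choose_spec (⟨x, h1⟩ : ∃ x, Tendsto _ _ (𝓝 x))) h1⟩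

theorem dist_le_of_mem_cauchyRep {p : ℕ → ℕ} {x : X} (h : x ∈ C.cauchyRep.toFun p) (k : ℕ) :
    dist x (C.α (p k)) ≤ (1 / 2 : ℝ) ^ k := by
  rw [mem_cauchyRep] at h
  exact le_of_tendsto (h.1.dist tendsto_const_nhds)
    ((eventually_ge_atTop k).mono fun n hn => (h.2 k n hn).le)

theorem const_mem_cauchyRep (a : ℕ) : C.α a ∈ C.cauchyRep.toFun fun _ => a := by
  rw [mem_cauchyRep]
  refine ⟨tendsto_const_nhds, fun k n _ => ?_⟩
  rw [dist_self]; positivity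

end ComputableMetric

/-! ### Names of sequences -/

theorem mem_seqRep {X : Type*} {δ : Representation X} {p : ℕ → ℕ} {s : ℕ → X} :
    s ∈ (seqRep δ).toFun p ↔ ∀ i, s i ∈ δ.toFun fun j => p (Nat.pair i j) := by
  constructor
  · rintro ⟨h, rfl⟩ i
    exact ⟨h i, rfl⟩
  · intro h
    exact ⟨fun i => (h i).1, funext fun i => (h i).2⟩

theorem some_mem_optionRep {X : Type*} {δ : Representation X} {p : ℕ → ℕ} {x : X} :
    some x ∈ (optionRep δ).toFun p ↔ p 0 = 0 ∧ x ∈ δ.toFun fun n => p (n + 1) := by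
  unfold optionRep
  by_cases h : p 0 = 0 <;> simp [h]

theorem none_mem_optionRep {X : Type*} {δ : Representation X} {p : ℕ → ℕ} :
    none ∈ (optionRep δ).toFun p ↔ p 0 ≠ 0 := by
  unfold optionRep
  by_cases h : p 0 = 0 <;> simp [h]

/-! ### Initial segments -/

/-- The list of the first `k` values of `q`. -/
def initSeg (q : ℕ → ℕ) (k : ℕ) : List ℕ := (List.range k).map q

theorem initSeg_succ (q : ℕ → ℕ) (k : ℕ) : initSeg q (k + 1) = initSeg q k ++ [q k] := by
  simp [initSeg, List.range_succ]

@[simp] theorem length_initSeg (q : ℕ → ℕ) (k : ℕ) : (initSeg q k).length = k := by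
  simp [initSeg]

theorem take_initSeg (q : ℕ → ℕ) {i k : ℕ} (h : i ≤ k) : (initSeg q k).take i = initSeg q i := by
  simp [initSeg, ← List.map_take, List.take_range, h]

theorem initSeg_ne_nil (q : ℕ → ℕ) {k : ℕ} (h : 1 ≤ k) : initSeg q k ≠ [] := by
  intro h0
  have := congrArg List.length h0
  simp at this
  omega

theorem initSeg_congr {q q' : ℕ → ℕ} {k : ℕ} (h : ∀ i < k, q i = q' i) :
    initSeg q k = initSeg q' k :=
  List.map_congr_left fun i hi => h i (List.mem_range.1 hi)

theorem initSeg_getD (s : List ℕ) : initSeg (fun i => s.getD i 0) s.length = s := by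
  apply List.ext_getElem
  · simp
  · intro i h1 h2
    simp [initSeg, h2]

theorem initSeg_eq_iff {q q' : ℕ → ℕ} {k : ℕ} : initSeg q k = initSeg q' k ↔ ∀ i < k, q i = q' i := by
  simp [initSeg]

theorem half_pow_le {k n : ℕ} (h : k ≤ n) : (1 / 2 : ℝ) ^ n ≤ (1 / 2 : ℝ) ^ k :=
  pow_le_pow_of_le_one (by norm_num) (by norm_num) h

theorem exists_half_pow_lt {ε : ℝ} (hε : 0 < ε) : ∃ n, ∀ k ≥ n, (1 / 2 : ℝ) ^ k < ε := by
  obtain ⟨n, hn⟩ := exists_pow_lt_of_lt_one hε (by norm_num : (1 / 2 : ℝ) < 1)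
  exact ⟨n, fun k hk => (half_pow_le hk).trans_lt hn⟩

/-! ### Systems of open sets -/

/-- A computable system of open sets: a decreasing family `U s` of sets, indexed by finite
sequences, of diameters that tend to zero with the length of `s`, with a computable choice `c s` of
(the index of) a point of `U s` and a computable test `T s j e` that accepts only if
the ball with center `α j` and radius `4 * 2⁻ᵉ` is contained in `U s`, and that accepts near
every given point of `U s` as soon as `e` is large. In particular the sets `U s` are open. The bound
on the diameter exempts `U []`, which may be an unbounded space. -/
structure System {X : Type*} [MetricSpace X] (C : ComputableMetric X) where
  U : List ℕ → Set X
  c : List ℕ → ℕ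
  T : List ℕ → ℕ → ℕ → Bool
  computable_c : Computable c
  computable_T : Computable fun t : List ℕ × ℕ × ℕ => T t.1 t.2.1 t.2.2
  mem_c : ∀ s, C.α (c s) ∈ U s
  mono : ∀ s n, U (s ++ [n]) ⊆ U s
  dist_le : ∀ s, s ≠ [] → ∀ x ∈ U s, dist x (C.α (c s)) ≤ (1 / 2 : ℝ) ^ s.length
  sound : ∀ s j e, T s j e = true → Metric.closedBall (C.α j) (4 * (1 / 2 : ℝ) ^ e) ⊆ U s
  complete : ∀ s, ∀ x ∈ U s, ∃ δ > 0, ∃ e₀, ∀ e ≥ e₀, ∀ j, dist x (C.α j) < δ → T s j e = true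

namespace System

section Basic

variable {X : Type*} [MetricSpace X] {C : ComputableMetric X} (S : System C)

attribute [fun_prop] computable_c computable_T

theorem mem_of_test {s : List ℕ} {j e : ℕ} {x : X} (h : S.T s j e = true)
    (hx : dist x (C.α j) ≤ (1 / 2 : ℝ) ^ e) : x ∈ S.U s := by
  refine S.sound s j e h (Metric.mem_closedBall.2 (hx.trans ?_))
  have : (0 : ℝ) < (1 / 2 : ℝ) ^ e := by positivity
  linarith

/-- A fast converging sequence of approximations of a point of `U s` passes the test. -/
theorem exists_test {s : List ℕ} {x : X} (hx : x ∈ S.U s) {q : ℕ → ℕ}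
    (hq : ∀ k, dist x (C.α (q k)) ≤ (1 / 2 : ℝ) ^ k) : ∃ e₀, ∀ e ≥ e₀, S.T s (q e) e = true := by
  obtain ⟨δ, hδ, e₀, he⟩ := S.complete s x hx
  obtain ⟨n, hn⟩ := exists_half_pow_lt hδ
  refine ⟨max e₀ n, fun e h => he e (le_of_max_le_left h) _ ((hq e).trans_lt (hn e ?_))⟩
  exact le_of_max_le_right h

theorem isOpen_U (s : List ℕ) : IsOpen (S.U s) := by
  rw [Metric.isOpen_iff]
  intro x hx
  obtain ⟨δ, hδ, e₀, he⟩ := S.complete s x hx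
  have hpos : (0 : ℝ) < (1 / 2 : ℝ) ^ e₀ := by positivity
  obtain ⟨j, hj⟩ := C.dense.exists_dist_lt x (lt_min hδ hpos)
  have h := S.sound s j e₀ (he e₀ le_rfl j (hj.trans_le (min_le_left _ _)))
  refine ⟨(1 / 2 : ℝ) ^ e₀, hpos, fun y hy => h ?_⟩
  have h1 := dist_triangle y x (C.α j)
  have h2 := hj.trans_le (min_le_right _ _)
  rw [Metric.mem_ball] at hy
  rw [Metric.mem_closedBall]
  linarith

theorem mono_append (s t : List ℕ) : S.U (s ++ t) ⊆ S.U s := by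
  induction t using List.reverseRecOn with
  | nil => simp
  | append_singleton t n ih =>
    rw [← List.append_assoc]
    exact (S.mono _ _).trans ih

theorem mono_take (s : List ℕ) (k : ℕ) : S.U s ⊆ S.U (s.take k) := by
  conv_lhs => rw [← List.take_append_drop k s]
  exact S.mono_append _ _

theorem mono_initSeg (q : ℕ → ℕ) {i k : ℕ} (h : i ≤ k) :
    S.U (initSeg q k) ⊆ S.U (initSeg q i) := by
  rw [← take_initSeg q h]
  exact S.mono_take _ _

/-- The sets along a branch eventually are contained in any neighborhood of a point of their
intersection. -/
theorem exists_subset_of_mem_nhds {q : ℕ → ℕ} {x : X} (hx : ∀ k, x ∈ S.U (initSeg q k))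
    {W : Set X} (hW : W ∈ 𝓝 x) : ∃ n, ∀ k ≥ n, S.U (initSeg q k) ⊆ W := by
  obtain ⟨ε, hε, hsub⟩ := Metric.mem_nhds_iff.1 hW
  obtain ⟨n, hn⟩ := exists_half_pow_lt (half_pos hε)
  refine ⟨max n 1, fun k hk y hy => hsub ?_⟩
  have h1 : initSeg q k ≠ [] := initSeg_ne_nil q (le_of_max_le_right hk)
  have h2 := S.dist_le _ h1 y hy
  have h3 := S.dist_le _ h1 x (hx k)
  have h4 := hn k (le_of_max_le_left hk)
  have h5 := dist_triangle_right y x (C.α (S.c (initSeg q k)))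
  rw [length_initSeg] at h2 h3
  rw [Metric.mem_ball]
  linarith

/-- A decidable criterion for the inclusion of `U s` in a rational ball. -/
def inBall (s : List ℕ) (m : ℕ) : Bool :=
  !decide (s = []) &&
    Nat.ble ((C.approx (S.c s) m.unpair.1 s.length + 3) * (m.unpair.2.unpair.2.unpair.2 + 1)
        + m.unpair.2.unpair.2.unpair.1 * 2 ^ s.length + 1)
      (m.unpair.2.unpair.1 * 2 ^ s.length)

@[fun_prop] theorem computable_inBall : Computable fun t : List ℕ × ℕ => S.inBall t.1 t.2 := by
  have h1 := C.computable_approx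
  unfold inBall
  fun_prop

theorem inBall_iff (s : List ℕ) (m : ℕ) : S.inBall s m = true ↔ s ≠ [] ∧
    (C.approx (S.c s) m.unpair.1 s.length + 3 : ℝ) < rat m.unpair.2 * 2 ^ s.length := by
  unfold inBall rat
  simp only [Bool.and_eq_true, Bool.not_eq_true', decide_eq_false_iff_not, Nat.ble_eq,
    Nat.add_one_le_iff]
  refine and_congr_right fun _ => ?_
  generalize m.unpair.2.unpair.1 = a
  generalize m.unpair.2.unpair.2.unpair.1 = b
  generalize m.unpair.2.unpair.2.unpair.2 = c
  push_cast
  rw [← mul_div_right_comm, lt_div_iff₀ (by positivity)]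
  rw [← Nat.cast_lt (α := ℝ)]
  push_cast
  constructor <;> intro h <;> linarith

theorem subset_of_inBall {s : List ℕ} {m : ℕ} (h : S.inBall s m = true) :
    S.U s ⊆ C.ratBall m := by
  obtain ⟨h0, h1⟩ := (S.inBall_iff s m).1 h
  intro x hx
  have h2 := S.dist_le s h0 x hx
  have h3 := C.le_approx (S.c s) m.unpair.1 s.length
  have hP : (0 : ℝ) < 2 ^ s.length := by positivity
  have hpow : (1 / 2 : ℝ) ^ s.length * 2 ^ s.length = 1 := by rw [← mul_pow]; norm_num
  have h4 := dist_triangle x (C.α (S.c s)) (C.α m.unpair.1)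
  show dist x _ < _
  by_contra hcon
  push Not at hcon
  nlinarith

theorem exists_inBall {q : ℕ → ℕ} {x : X} (hx : ∀ k, x ∈ S.U (initSeg q k)) {m : ℕ}
    (hm : x ∈ C.ratBall m) : ∃ n, ∀ k ≥ n, S.inBall (initSeg q k) m = true := by
  have hm' : dist x (C.α m.unpair.1) < rat m.unpair.2 := hm
  obtain ⟨n, hn⟩ := exists_half_pow_lt (ε := (rat m.unpair.2 - dist x (C.α m.unpair.1)) / 6)
    (by linarith)
  refine ⟨max n 1, fun k hk => ?_⟩
  have h0 : initSeg q k ≠ [] := initSeg_ne_nil q (le_of_max_le_right hk)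
  refine (S.inBall_iff _ _).2 ⟨h0, ?_⟩
  have h1 := C.approx_le (S.c (initSeg q k)) m.unpair.1 k
  have h2 := S.dist_le _ h0 x (hx k)
  have h3 := hn k (le_of_max_le_left hk)
  have hP : (0 : ℝ) < 2 ^ k := by positivity
  have hpow : (1 / 2 : ℝ) ^ k * 2 ^ k = 1 := by rw [← mul_pow]; norm_num
  have h4 := dist_triangle_left (C.α (S.c (initSeg q k))) (C.α m.unpair.1) x
  rw [length_initSeg] at h2 ⊢
  nlinarith

end Basic

/-- A system is a *source* if every point of `U s` belongs to some child of `U s`, and if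
every branch has a point in its intersection. -/
structure IsSource {X : Type*} [MetricSpace X] {C : ComputableMetric X} (S : System C) :
    Prop where
  cover : ∀ s, ∀ x ∈ S.U s, ∃ n, x ∈ S.U (s ++ [n])
  branch : ∀ q, ∃ x, ∀ k, x ∈ S.U (initSeg q k)

/-- A system is a *target* if `U []` is the whole space, siblings are disjoint, and every
member of the dense sequence that belongs to `U s` belongs to some child of `U s`. -/
structure IsTarget {X : Type*} [MetricSpace X] {C : ComputableMetric X} (S : System C) :
    Prop where
  root : S.U [] = univ
  disjoint : ∀ s m n, m ≠ n → Disjoint (S.U (s ++ [m])) (S.U (s ++ [n]))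
  cover : ∀ s j, C.α j ∈ S.U s → ∃ n, C.α j ∈ S.U (s ++ [n])

section Branches

variable {X : Type*} [MetricSpace X] {C : ComputableMetric X} {S : System C}

theorem IsSource.exists_branch (hS : S.IsSource) {s : List ℕ} {x : X} (hx : x ∈ S.U s) :
    ∃ q, initSeg q s.length = s ∧ ∀ k, x ∈ S.U (initSeg q k) := by
  choose! f hf using hS.cover
  let t : ℕ → List ℕ := fun n => Nat.rec s (fun _ t => t ++ [f t x]) n
  have ht : ∀ n, t (n + 1) = t n ++ [f (t n) x] := fun n => rfl
  have hmem : ∀ n, x ∈ S.U (t n) := by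
    intro n
    induction n with
    | zero => exact hx
    | succ n ih => rw [ht]; exact hf _ _ ih
  have hlen : ∀ n, (t n).length = s.length + n := by
    intro n
    induction n with
    | zero => rfl
    | succ n ih => rw [ht]; simp [ih, add_assoc]
  let q : ℕ → ℕ := fun i => if i < s.length then s.getD i 0 else f (t (i - s.length)) x
  have hq0 : initSeg q s.length = s := by
    conv_rhs => rw [← initSeg_getD s]
    exact initSeg_congr fun i hi => by simp [q, hi]
  have hq : ∀ n, initSeg q (s.length + n) = t n := by
    intro n
    induction n with
    | zero => exact hq0
    | succ n ih =>
      rw [← add_assoc, initSeg_succ, ih, ht]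
      simp [q]
  refine ⟨q, hq0, fun k => ?_⟩
  have := hmem k
  rw [← hq] at this
  exact S.mono_initSeg q (by omega) this

variable (hS : S.IsTarget)

include hS

theorem IsTarget.eq_of_length_eq {y : X} : ∀ {s t : List ℕ}, s.length = t.length →
    y ∈ S.U s → y ∈ S.U t → s = t := by
  intro s
  induction s using List.reverseRecOn with
  | nil =>
    intro t h _ _
    exact (List.length_eq_zero_iff.1 h.symm).symm
  | append_singleton s m ih =>
    intro t h hs ht
    rcases List.eq_nil_or_concat t with rfl | ⟨t, n, rfl⟩
    · simp at h
    · rw [List.concat_eq_append] at h ht ⊢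
      have hst : s = t := ih (by simpa using h) (S.mono _ _ hs) (S.mono _ _ ht)
      subst hst
      by_cases hmn : m = n
      · rw [hmn]
      · exact absurd ht (disjoint_left.1 (hS.disjoint s m n hmn) hs)

theorem IsTarget.eq_take {y : X} {s t : List ℕ} (h : s.length ≤ t.length)
    (hs : y ∈ S.U s) (ht : y ∈ S.U t) : s = t.take s.length :=
  hS.eq_of_length_eq (by simp [h]) hs (S.mono_take _ _ ht)

theorem IsTarget.exists_extension {s : List ℕ} {j : ℕ} (h : C.α j ∈ S.U s) (n : ℕ) :
    ∃ t, (s ++ t).length = s.length + n ∧ C.α j ∈ S.U (s ++ t) := by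
  induction n with
  | zero => exact ⟨[], by simp, by simpa using h⟩
  | succ n ih =>
    obtain ⟨t, h1, h2⟩ := ih
    obtain ⟨m, hm⟩ := hS.cover _ _ h2
    refine ⟨t ++ [m], ?_, ?_⟩
    · rw [← List.append_assoc, List.length_append, h1]; simp [add_assoc]
    · rwa [← List.append_assoc]

theorem IsTarget.exists_mem (j k : ℕ) : ∃ s, s.length = k ∧ C.α j ∈ S.U s := by
  obtain ⟨t, h1, h2⟩ := hS.exists_extension (s := []) (j := j) (by rw [hS.root]; trivial) k
  exact ⟨t, by simpa using h1, by simpa using h2⟩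

/-- A nonempty open set contains a set of the system, of any prescribed minimal length. -/
theorem IsTarget.exists_subset {W : Set X} (hW : IsOpen W) (hne : W.Nonempty) (n : ℕ) :
    ∃ s, n ≤ s.length ∧ S.U s ⊆ W := by
  obtain ⟨j, hj⟩ := C.dense.exists_mem_open hW hne
  obtain ⟨ε, hε, hsub⟩ := Metric.isOpen_iff.1 hW _ hj
  obtain ⟨k, hk⟩ := exists_half_pow_lt (half_pos hε)
  obtain ⟨s, hs, hmem⟩ := hS.exists_mem j (max (max k n) 1)
  have h0 : s ≠ [] := by
    intro h
    rw [h, List.length_nil] at hs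
    have := le_max_right (max k n) 1
    omega
  refine ⟨s, by rw [hs]; exact (le_max_right k n).trans (le_max_left _ _), fun y hy => hsub ?_⟩
  have h1 := S.dist_le s h0 y hy
  have h2 := S.dist_le s h0 _ hmem
  have h3 := hk s.length (by rw [hs]; exact (le_max_left k n).trans (le_max_left _ _))
  have h4 := dist_triangle_right y (C.α j) (C.α (S.c s))
  rw [Metric.mem_ball]
  linarith

theorem IsTarget.exists_branch {y : X} (h : ∀ i, ∃ s, i ≤ s.length ∧ y ∈ S.U s) :
    ∃ q, ∀ k, y ∈ S.U (initSeg q k) := by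
  have h' : ∀ i, ∃ s, s.length = i ∧ y ∈ S.U s := fun i => by
    obtain ⟨s, hs, hy⟩ := h i
    exact ⟨s.take i, by simp [hs], S.mono_take _ _ hy⟩
  choose t ht hy using h'
  refine ⟨fun i => (t (i + 1)).getD i 0, fun k => ?_⟩
  suffices hk : initSeg (fun i => (t (i + 1)).getD i 0) k = t k by rw [hk]; exact hy k
  induction k with
  | zero => exact (List.length_eq_zero_iff.1 (ht 0)).symm
  | succ k ih =>
    rw [initSeg_succ, ih]
    have h1 := hS.eq_take (by rw [ht, ht]; omega) (hy k) (hy (k + 1))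
    rw [ht] at h1
    have h2 := List.take_append_getElem (l := t (k + 1)) (i := k) (by rw [ht]; omega)
    rw [← h1] at h2
    rw [List.getD_eq_getElem _ _ (by rw [ht]; omega), h2, List.take_of_length_le (by rw [ht])]

/-- If no point `c s` with a long index `s` in `A` belongs to the open subset `N`
of `U t`, then `N` is not contained in the closure of `{c s | s ∈ A}`: only the finitely many
restrictions `s` of `t` can have `c s ∈ N`, and there are no isolated points. -/
theorem IsTarget.not_subset_closure [PerfectSpace X] {A : Set (List ℕ)} {t : List ℕ} {N : Set X}
    (hN : IsOpen N) (hne : N.Nonempty) (hNt : N ⊆ S.U t)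
    (hA : ∀ s ∈ A, t.length ≤ s.length → C.α (S.c s) ∉ N) :
    ¬ N ⊆ closure ((fun s => C.α (S.c s)) '' A) := by
  intro hsub
  let F : Set X := (fun i => C.α (S.c (t.take i))) '' Iic t.length
  have hF : F.Finite := (finite_Iic _).image _
  have hNF : N ⊆ F := by
    intro y hy
    by_contra hyF
    have hopen : IsOpen (N ∩ Fᶜ) := hN.inter hF.isClosed.isOpen_compl
    obtain ⟨_, ⟨hz1, hz2⟩, s, hs, rfl⟩ := mem_closure_iff.1 (hsub hy) _ hopen ⟨hy, hyF⟩
    rcases le_total t.length s.length with h | h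
    · exact hA s hs h hz1
    · refine hz2 ⟨s.length, h, ?_⟩
      show C.α (S.c (t.take s.length)) = C.α (S.c s)
      rw [← hS.eq_take h (S.mem_c s) (hNt hz1)]
  obtain ⟨y, hy⟩ := hne
  have hinf : N.Infinite := infinite_of_mem_nhds y (hN.mem_nhds hy)
  exact hinf (hF.subset hNF)

end Branches

end System

/-! ### Transfer of closed sets along a pair of systems -/

theorem strongReducible_of {X Y Z W : Type*} {δX : Representation X} {δY : Representation Y}
    {δZ : Representation Z} {δW : Representation W} {f : MultiFun δX δY} {g : MultiFun δZ δW}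
    {K : (ℕ → ℕ) → ℕ → ℕ} {H : (ℕ → ℕ) →. (ℕ → ℕ)}
    (hK : ComputableBaire fun p => Part.some (K p)) (hH : ComputableBaire H)
    (h : ∀ p, ∀ x ∈ δX.toFun p, x ∈ f.dom → ∃ z ∈ δZ.toFun (K p), z ∈ g.dom ∧
      ∀ q, ∀ w ∈ δW.toFun q, w ∈ g.val z → ∃ r ∈ H q, ∃ y ∈ δY.toFun r, y ∈ f.val x) :
    StrongReducible f g := by
  refine ⟨_, H, hK, hH, fun G hG p x hx hdom => ?_⟩
  obtain ⟨z, hz, hzdom, hval⟩ := h p x hx hdom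
  obtain ⟨q, hq, w, hw, hwval⟩ := hG _ z hz hzdom
  obtain ⟨r, hr, y, hy, hyval⟩ := hval q w hw hwval
  refine ⟨r, ?_, y, hy, hyval⟩
  exact Part.mem_bind (Part.mem_bind (Part.mem_some _) hq) hr

namespace System

variable {X Y : Type*} [MetricSpace X] [MetricSpace Y] {C : ComputableMetric X}
  {D : ComputableMetric Y} (S : System C) (R : System D)

/-- The closed set `B ⊆ Y` is a substitute of the closed set `A ⊆ X` for the purposes of the Baire
category theorem: it contains every `y` whose branch is shared by a point of `A`, and every `y`
that is missed by the `i`-th level of the system on `Y`, but its interior is empty whenever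
that of `A` is. -/
structure Transfers (i : ℕ) (A : Set X) (B : Set Y) : Prop where
  mem : ∀ q x y, (∀ k, x ∈ S.U (initSeg q k)) → (∀ k, y ∈ R.U (initSeg q k)) → x ∈ A → y ∈ B
  boundary : ∀ y, (∀ s, i ≤ s.length → y ∉ R.U s) → y ∈ B
  interior : interior A = ∅ → interior B = ∅

/-- The partial function that maps a name of a point of `Y` on a branch of `R` to a name of the
point of `X` on the same branch of `S`. -/
def branchFun : (ℕ → ℕ) →. (ℕ → ℕ) :=
  searchFun
    (fun t => decide ((listOf t.2.1.unpair.1).length = t.1 + 1) &&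
      R.T (listOf t.2.1.unpair.1) t.2.2 t.2.1.unpair.2)
    (fun w => w.unpair.2) (fun w => S.c (listOf w.unpair.1))

theorem computableBaire_branchFun : ComputableBaire (branchFun S R) := by
  have h1 := R.computable_T
  have h2 := S.computable_c
  exact ComputableBaire.searchFun (by fun_prop) (by fun_prop) (by fun_prop)

variable {S R}

theorem exists_mem_branchFun (hR : R.IsTarget) {p : ℕ → ℕ} {y : Y}
    (hp : y ∈ D.cauchyRep.toFun p) {q : ℕ → ℕ} (hy : ∀ k, y ∈ R.U (initSeg q k)) {x : X}
    (hx : ∀ k, x ∈ S.U (initSeg q k)) : ∃ r ∈ branchFun S R p, x ∈ C.cauchyRep.toFun r := by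
  have hdist := D.dist_le_of_mem_cauchyRep hp
  refine ⟨fun n => S.c (initSeg q (n + 1)), mem_searchFun (fun n => ?_) fun n w h => ?_, ?_⟩
  · obtain ⟨e, he⟩ := R.exists_test (hy (n + 1)) hdist
    refine ⟨Nat.pair (Encodable.encode (initSeg q (n + 1))) e, ?_⟩
    simp [he e le_rfl]
  · rw [Bool.and_eq_true, decide_eq_true_eq] at h
    refine congrArg S.c (hR.eq_of_length_eq ?_ (R.mem_of_test h.2 (hdist _)) (hy (n + 1)))
    rw [length_initSeg]
    exact h.1
  rw [ComputableMetric.mem_cauchyRep]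
  refine ⟨?_, fun k n hkn => ?_⟩
  · rw [tendsto_iff_dist_tendsto_zero]
    refine squeeze_zero (fun _ => dist_nonneg) (fun n => ?_)
      (tendsto_pow_atTop_nhds_zero_of_lt_one (r := (1 / 2 : ℝ)) (by norm_num) (by norm_num))
    rw [dist_comm]
    refine (S.dist_le _ (initSeg_ne_nil q (by omega)) x (hx _)).trans ?_
    rw [length_initSeg]
    exact half_pow_le (by omega)
  · refine (S.dist_le _ (initSeg_ne_nil q (by omega)) _
      (S.mono_initSeg q (by omega : k + 1 ≤ n + 1) (S.mem_c _))).trans_lt ?_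
    rw [length_initSeg, pow_succ]
    have : (0 : ℝ) < (1 / 2 : ℝ) ^ k := by positivity
    linarith

section Reductions

variable {δ : Representation (TopologicalSpace.Closeds X)}
  {δ' : Representation (TopologicalSpace.Closeds Y)} {K : (ℕ → ℕ) → ℕ → ℕ}

/-- A point outside of all substitutes lies on a branch, hence determines a point of
`X`, which is outside of all the given sets. -/
theorem strongReducible_avoid (hS : S.IsSource) (hR : R.IsTarget)
    (hK : ComputableBaire fun p => Part.some (K p))
    (h : ∀ p, ∀ A ∈ (seqRep δ).toFun p, ∃ B ∈ (seqRep δ').toFun (K p),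
      ∀ i, Transfers S R i (A i : Set X) (B i : Set Y)) :
    StrongReducible
      (⟨{A | ∀ i, interior (A i : Set X) = ∅}, fun A => (⋃ i, (A i : Set X))ᶜ⟩ :
        MultiFun (seqRep δ) C.cauchyRep)
      (⟨{A | ∀ i, interior (A i : Set Y) = ∅}, fun A => (⋃ i, (A i : Set Y))ᶜ⟩ :
        MultiFun (seqRep δ') D.cauchyRep) := by
  refine strongReducible_of hK (computableBaire_branchFun S R) fun p A hA hdom => ?_
  obtain ⟨B, hB, hAB⟩ := h p A hA
  refine ⟨B, hB, fun i => (hAB i).interior (hdom i), fun p' y hy hyB => ?_⟩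
  simp only [mem_compl_iff, mem_iUnion, not_exists] at hyB
  obtain ⟨q, hq⟩ : ∃ q, ∀ k, y ∈ R.U (initSeg q k) := by
    refine hR.exists_branch fun i => ?_
    by_contra hcon
    push Not at hcon
    exact hyB i ((hAB i).boundary y hcon)
  obtain ⟨x, hx⟩ := hS.branch q
  obtain ⟨r, hr, hrx⟩ := exists_mem_branchFun hR hy hq hx
  refine ⟨r, hr, x, hrx, ?_⟩
  simp only [mem_compl_iff, mem_iUnion, not_exists]
  exact fun i hi => hyB i ((hAB i).mem q x y hx hq hi)

/-- The sets `B i` cover `Y`, as a point outside of all of them would determine a point of `X`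
outside of all the sets `A i`. The same index solves both problems. -/
theorem strongReducible_index (hS : S.IsSource) (hR : R.IsTarget)
    (hK : ComputableBaire fun p => Part.some (K p))
    (h : ∀ p, ∀ A ∈ (seqRep δ).toFun p, ∃ B ∈ (seqRep δ').toFun (K p),
      ∀ i, Transfers S R i (A i : Set X) (B i : Set Y)) :
    StrongReducible
      (⟨{A | ⋃ i, (A i : Set X) = univ}, fun A => {i | interior (A i : Set X) ≠ ∅}⟩ :
        MultiFun (seqRep δ) natRep)
      (⟨{A | ⋃ i, (A i : Set Y) = univ}, fun A => {i | interior (A i : Set Y) ≠ ∅}⟩ :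
        MultiFun (seqRep δ') natRep) := by
  refine strongReducible_of hK ComputableBaire.id fun p A hA hdom => ?_
  obtain ⟨B, hB, hAB⟩ := h p A hA
  refine ⟨B, hB, ?_, fun p' i hi hiB => ⟨p', Part.mem_some _, i, hi, ?_⟩⟩
  · refine eq_univ_of_forall fun y => ?_
    by_contra hyB
    simp only [mem_iUnion, not_exists] at hyB
    obtain ⟨q, hq⟩ : ∃ q, ∀ k, y ∈ R.U (initSeg q k) := by
      refine hR.exists_branch fun i => ?_
      by_contra hcon
      push Not at hcon
      exact hyB i ((hAB i).boundary y hcon)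
    obtain ⟨x, hx⟩ := hS.branch q
    have hxA : x ∈ ⋃ i, (A i : Set X) := by
      rw [show (⋃ i, (A i : Set X)) = univ from hdom]; trivial
    obtain ⟨i, hi⟩ := mem_iUnion.1 hxA
    exact hyB i ((hAB i).mem q x y hx hq hi)
  · exact fun h0 => hiB ((hAB i).interior h0)

end Reductions

/-! ### Negative information -/

variable (S R)

/-- The code of the rational number `2⁻ᵉ`. -/
def halfPowCode (e : ℕ) : ℕ := Nat.pair 1 (Nat.pair 0 (2 ^ e - 1))

@[fun_prop] theorem computable_halfPowCode : Computable halfPowCode :=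
  computable_natPair (Computable.const 1) (computable_natPair (Computable.const 0)
    (computable_sub (computable_two_pow Computable.id) (Computable.const 1)))

/-- A ball contained in the set with index `s`, given by its center `a` and the exponent `e` of
its radius, if `i ≤ |s|` and the other set with index `s` is contained in the ball `v`. The
default value `0` denotes an empty ball. -/
def negBall (i : ℕ) (s : List ℕ) (v a e : ℕ) : ℕ :=
  if (Nat.ble i s.length && (S.inBall s v && R.T s a e)) = true then
    Nat.pair a (halfPowCode e)
  else 0

theorem computable_negBall : Computable fun t : ℕ × List ℕ × ℕ × ℕ × ℕ =>
    negBall S R t.1 t.2.1 t.2.2.1 t.2.2.2.1 t.2.2.2.2 := by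
  have h1 := R.computable_T
  have h2 := S.computable_inBall
  unfold negBall
  fun_prop

/-- The translation of negative information: whenever `U s` is contained in a ball of the given
name, with `i ≤ |s|`, the set with index `s` on the other side is removed as well. -/
def negFun (p : ℕ → ℕ) (n : ℕ) : ℕ :=
  negBall S R n.unpair.1 (listOf n.unpair.2.unpair.2.unpair.1)
    (p (Nat.pair n.unpair.1 n.unpair.2.unpair.1))
    n.unpair.2.unpair.2.unpair.2.unpair.1 n.unpair.2.unpair.2.unpair.2.unpair.2

theorem computableBaire_negFun : ComputableBaire fun p => Part.some (negFun S R p) := by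
  have h1 := computable_negBall S R
  exact ComputableBaire.of_two_queries
    (ψ := fun t => negBall S R t.1.unpair.1 (listOf t.1.unpair.2.unpair.2.unpair.1) t.2.1
      t.1.unpair.2.unpair.2.unpair.2.unpair.1 t.1.unpair.2.unpair.2.unpair.2.unpair.2)
    (u := fun n => Nat.pair n.unpair.1 n.unpair.2.unpair.1) (v := fun n => n)
    (by fun_prop) (by fun_prop) (by fun_prop)

theorem ratBall_two_pow {X : Type*} [MetricSpace X] (C : ComputableMetric X) (j e : ℕ) :
    C.ratBall (Nat.pair j (halfPowCode e)) =
      Metric.ball (C.α j) ((1 / 2 : ℝ) ^ e) := by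
  have h2 : ((2 ^ e - 1 : ℕ) : ℚ) + 1 = 2 ^ e := by
    have : 2 ^ e - 1 + 1 = 2 ^ e := Nat.sub_add_cancel Nat.one_le_two_pow
    exact_mod_cast this
  simp only [halfPowCode, ComputableMetric.ratBall, Nat.unpair_pair, rat_pair, h2]
  push_cast
  simp

theorem ratBall_zero {X : Type*} [MetricSpace X] (C : ComputableMetric X) :
    C.ratBall 0 = ∅ := by
  simp [ComputableMetric.ratBall, rat]

/-- The set denoted by a row of `negFun`. -/
theorem iUnion_ratBall_negFun (p : ℕ → ℕ) (i : ℕ) :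
    ⋃ l, D.ratBall (negFun S R p (Nat.pair i l)) =
      {y | ∃ s j, i ≤ s.length ∧ S.inBall s (p (Nat.pair i j)) = true ∧ y ∈ R.U s} := by
  ext y
  simp only [mem_iUnion, mem_ofPred_eq]
  constructor
  · rintro ⟨l, hl⟩
    unfold negFun negBall at hl
    split_ifs at hl with h
    · rw [ratBall_two_pow] at hl
      simp only [Nat.unpair_pair, Bool.and_eq_true, Nat.ble_eq] at h hl
      exact ⟨_, _, h.1, h.2.1, R.mem_of_test h.2.2 (Metric.mem_ball.1 hl).le⟩
    · rw [ratBall_zero] at hl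
      exact hl.elim
  · rintro ⟨s, j, h1, h2, h3⟩
    obtain ⟨δ, hδ, e₀, he⟩ := R.complete s y h3
    have hpos : (0 : ℝ) < (1 / 2 : ℝ) ^ e₀ := by positivity
    obtain ⟨a, ha⟩ := D.dense.exists_dist_lt y (lt_min hδ hpos)
    refine ⟨Nat.pair j (Nat.pair (Encodable.encode s) (Nat.pair a e₀)), ?_⟩
    have hT := he e₀ le_rfl a (ha.trans_le (min_le_left _ _))
    unfold negFun negBall
    simp only [Nat.unpair_pair, listOf_encode]
    rw [if_pos (by simp [h1, h2, hT]), ratBall_two_pow]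
    exact ha.trans_le (min_le_right _ _)

variable {S R}

theorem exists_transfers_neg (hS : S.IsSource) (hR : R.IsTarget) (p : ℕ → ℕ)
    (A : ℕ → TopologicalSpace.Closeds X) (hA : A ∈ (seqRep C.negRep).toFun p) :
    ∃ B ∈ (seqRep D.negRep).toFun (negFun S R p),
      ∀ i, Transfers S R i (A i : Set X) (B i : Set Y) := by
  refine ⟨fun i => ⟨(⋃ l, D.ratBall (negFun S R p (Nat.pair i l)))ᶜ,
    (isOpen_iUnion fun _ => Metric.isOpen_ball).isClosed_compl⟩,
    mem_seqRep.2 fun i => Part.mem_some _, fun i => ?_⟩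
  have hAi : (A i : Set X) = (⋃ j, C.ratBall (p (Nat.pair i j)))ᶜ := by
    rw [Part.mem_some_iff.1 (mem_seqRep.1 hA i)]
    rfl
  show Transfers S R i (A i : Set X) (⋃ l, D.ratBall (negFun S R p (Nat.pair i l)))ᶜ
  rw [iUnion_ratBall_negFun, hAi]
  constructor
  · rintro q x y hx hy hxA ⟨s, j, -, h2, h3⟩
    refine hxA (mem_iUnion.2 ⟨j, S.subset_of_inBall h2 ?_⟩)
    have hs : s = initSeg q s.length := hR.eq_of_length_eq (by simp) h3 (hy _)
    rw [hs]
    exact hx _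
  · rintro y hy ⟨s, j, h1, -, h3⟩
    exact hy s h1 h3
  · intro hint
    by_contra hne
    obtain ⟨s, -, hs⟩ := hR.exists_subset isOpen_interior (nonempty_iff_ne_empty.2 hne) 0
    -- As `U s` is not contained in the given set, a deeper set `U t` is contained in a ball of
    -- its name, and so the set with index `t` on the other side is removed.
    obtain ⟨x, hx, hxA⟩ : ∃ x ∈ S.U s, x ∈ ⋃ j, C.ratBall (p (Nat.pair i j)) := by
      by_contra hcon
      push Not at hcon
      have : S.U s ⊆ interior (⋃ j, C.ratBall (p (Nat.pair i j)))ᶜ :=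
        interior_maximal hcon (S.isOpen_U s)
      rw [hint] at this
      exact this (S.mem_c s)
    obtain ⟨q, hq, hxq⟩ := hS.exists_branch hx
    obtain ⟨j, hj⟩ := mem_iUnion.1 hxA
    obtain ⟨n, hn⟩ := S.exists_inBall hxq hj
    have hk := hn (max n (max i s.length)) (le_max_left _ _)
    have hmem := R.mem_c (initSeg q (max n (max i s.length)))
    refine interior_subset (hs ?_) ⟨_, j, ?_, hk, hmem⟩
    · have := R.mono_initSeg q ((le_max_right i s.length).trans (le_max_right n _)) hmem
      rwa [hq] at this
    · rw [length_initSeg]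
      exact (le_max_left _ _).trans (le_max_right _ _)

end System

/-! ### Positive information -/

theorem mem_posRep {X : Type*} [MetricSpace X] {C : ComputableMetric X} {p : ℕ → ℕ}
    {A : TopologicalSpace.Closeds X} : A ∈ C.posRep.toFun p ↔
      ∃ σ ∈ (seqRep (optionRep C.cauchyRep)).toFun p,
        (A : Set X) = closure {x | ∃ n, σ n = some x} := by
  unfold ComputableMetric.posRep
  simp only [Part.mem_map_iff]
  refine exists_congr fun σ => and_congr_right fun _ => ⟨fun h => ?_, fun h => ?_⟩
  · rw [← h]; rfl
  · exact TopologicalSpace.Closeds.ext h.symm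

namespace System

variable {X Y : Type*} [MetricSpace X] [MetricSpace Y] {C : ComputableMetric X}
  {D : ComputableMetric Y} (S : System C) (R : System D)

/-- The condition for the chosen point of the set with index `s` on `Y` to be enumerated. Either
the answers `v`, `w` of the oracle show that a given point of `X` belongs to `U s`; or the
chosen point is not seen to have, in comparison with `2 ^ -|s|`, a large distance from the
complement of the `i`-th level. The closure of the set of points of the second kind contains this
complement, but no nonempty open set. -/
def posTest (i : ℕ) (s : List ℕ) (v w e : ℕ) : Bool :=
  (decide (v = 0) && S.T s w e) || (Nat.ble i s.length && !(R.T (s.take i) (R.c s) s.length))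

theorem computable_posTest : Computable fun t : ℕ × List ℕ × ℕ × ℕ × ℕ =>
    posTest S R t.1 t.2.1 t.2.2.1 t.2.2.2.1 t.2.2.2.2 := by
  have h1 := R.computable_T
  have h2 := S.computable_T
  have h3 := R.computable_c
  unfold posTest
  fun_prop

/-- The `j`-th entry of a name of the chosen point of the set with index `s`, or of `∞`. -/
def posEntry (s : List ℕ) (b : Bool) (j : ℕ) : ℕ :=
  if b = true then if decide (j = 0) = true then 0 else R.c s else 1

theorem computable_posEntry : Computable fun t : List ℕ × Bool × ℕ =>
    posEntry R t.1 t.2.1 t.2.2 := by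
  have h3 := R.computable_c
  unfold posEntry
  fun_prop

/-- The translation of positive information. -/
def posFun (p : ℕ → ℕ) (n : ℕ) : ℕ :=
  posEntry R (listOf n.unpair.2.unpair.1.unpair.2.unpair.1)
    (posTest S R n.unpair.1 (listOf n.unpair.2.unpair.1.unpair.2.unpair.1)
      (p (Nat.pair n.unpair.1 (Nat.pair n.unpair.2.unpair.1.unpair.1 0)))
      (p (Nat.pair n.unpair.1 (Nat.pair n.unpair.2.unpair.1.unpair.1
        (n.unpair.2.unpair.1.unpair.2.unpair.2 + 1))))
      n.unpair.2.unpair.1.unpair.2.unpair.2)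
    n.unpair.2.unpair.2

theorem computableBaire_posFun : ComputableBaire fun p => Part.some (posFun S R p) := by
  have h1 := computable_posTest S R
  have h2 := computable_posEntry R
  exact ComputableBaire.of_two_queries
    (ψ := fun t => posEntry R (listOf t.1.unpair.2.unpair.1.unpair.2.unpair.1)
      (posTest S R t.1.unpair.1 (listOf t.1.unpair.2.unpair.1.unpair.2.unpair.1) t.2.1 t.2.2
        t.1.unpair.2.unpair.1.unpair.2.unpair.2) t.1.unpair.2.unpair.2)
    (u := fun n => Nat.pair n.unpair.1 (Nat.pair n.unpair.2.unpair.1.unpair.1 0))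
    (v := fun n => Nat.pair n.unpair.1 (Nat.pair n.unpair.2.unpair.1.unpair.1
        (n.unpair.2.unpair.1.unpair.2.unpair.2 + 1)))
    (by fun_prop) (by fun_prop) (by fun_prop)

/-- The indices of the points enumerated by the `i`-th row of `posFun`, when the `i`-th
given set is the closure of `A`. -/
def posIndices (i : ℕ) (A : Set X) : Set (List ℕ) :=
  {s | (∃ x ∈ A, x ∈ S.U s) ∨ (i ≤ s.length ∧ R.T (s.take i) (R.c s) s.length = false)}

variable {S R}

theorem mem_posRep_posFun {p : ℕ → ℕ} {i : ℕ} {σ : ℕ → Option X}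
    (hσ : σ ∈ (seqRep (optionRep C.cauchyRep)).toFun fun j => p (Nat.pair i j))
    {B : TopologicalSpace.Closeds Y} (hB : (B : Set Y) =
      closure ((fun s => D.α (R.c s)) '' posIndices S R i {x | ∃ n, σ n = some x})) :
    B ∈ D.posRep.toFun fun j => posFun S R p (Nat.pair i j) := by
  classical
  let b : ℕ → Bool := fun l => posTest S R i (listOf l.unpair.2.unpair.1)
    (p (Nat.pair i (Nat.pair l.unpair.1 0)))
    (p (Nat.pair i (Nat.pair l.unpair.1 (l.unpair.2.unpair.2 + 1)))) l.unpair.2.unpair.2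
  let τ : ℕ → Option Y := fun l =>
    if b l = true then some (D.α (R.c (listOf l.unpair.2.unpair.1))) else none
  have hrow : ∀ l j, posFun S R p (Nat.pair i (Nat.pair l j)) =
      posEntry R (listOf l.unpair.2.unpair.1) (b l) j := fun l j => by
    simp only [posFun, Nat.unpair_pair, b]
  refine mem_posRep.2 ⟨τ, mem_seqRep.2 fun l => ?_, ?_⟩
  · simp only [hrow, τ]
    cases hb : b l
    · simp [none_mem_optionRep, posEntry]
    · simp only [if_true, some_mem_optionRep, posEntry]
      exact ⟨by simp, by simpa using D.const_mem_cauchyRep _⟩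
  · rw [hB]
    congr 1
    ext y
    have hname := fun n => mem_seqRep.1 hσ n
    constructor
    · rintro ⟨s, hs, rfl⟩
      rcases hs with ⟨x, ⟨n, hn⟩, hx⟩ | ⟨h1, h2⟩
      · have h3 := hname n
        rw [hn, some_mem_optionRep] at h3
        obtain ⟨e, he⟩ := S.exists_test hx (C.dist_le_of_mem_cauchyRep h3.2)
        refine ⟨Nat.pair n (Nat.pair (Encodable.encode s) e), ?_⟩
        have hb : b (Nat.pair n (Nat.pair (Encodable.encode s) e)) = true := by
          have := he e le_rfl
          simp only [b, posTest, Nat.unpair_pair, listOf_encode]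
          simp [h3.1, this]
        simp [τ, hb]
      · refine ⟨Nat.pair 0 (Nat.pair (Encodable.encode s) 0), ?_⟩
        have hb : b (Nat.pair 0 (Nat.pair (Encodable.encode s) 0)) = true := by
          simp only [b, posTest, Nat.unpair_pair, listOf_encode]
          simp [h1, h2]
        simp [τ, hb]
    · rintro ⟨l, hl⟩
      by_cases hb : b l = true
      · simp only [τ, hb, if_true, Option.some.injEq] at hl
        refine ⟨_, ?_, hl⟩
        simp only [b, posTest, Bool.or_eq_true, Bool.and_eq_true, decide_eq_true_eq, Nat.ble_eq,
          Bool.not_eq_true'] at hb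
        refine hb.imp (fun h => ?_) id
        have h3 := hname l.unpair.1
        cases hn : σ l.unpair.1 with
        | none =>
          rw [hn, none_mem_optionRep] at h3
          exact absurd h.1 h3
        | some x =>
          rw [hn, some_mem_optionRep] at h3
          exact ⟨x, ⟨_, hn⟩, S.mem_of_test h.2 (C.dist_le_of_mem_cauchyRep h3.2 _)⟩
      · simp [τ, hb] at hl

theorem transfers_pos [PerfectSpace Y] (hS : S.IsSource) (hR : R.IsTarget) (i : ℕ) (A : Set X) :
    Transfers S R i (closure A)
      (closure ((fun s => D.α (R.c s)) '' posIndices S R i A)) := by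
  constructor
  · intro q x y hx hy hxA
    rw [mem_closure_iff_nhds]
    intro W hW
    obtain ⟨n, hn⟩ := R.exists_subset_of_mem_nhds hy hW
    obtain ⟨x', hx', hx'A⟩ := mem_closure_iff.1 hxA _ (S.isOpen_U (initSeg q n)) (hx n)
    exact ⟨_, hn n le_rfl (R.mem_c _), _, Or.inl ⟨x', hx'A, hx'⟩, rfl⟩
  · intro y hy
    rw [Metric.mem_closure_iff]
    intro ε hε
    obtain ⟨n, hn⟩ := exists_half_pow_lt (half_pos hε)
    let k := max n (max i 1)
    have hpos : (0 : ℝ) < (1 / 2 : ℝ) ^ k := by positivity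
    obtain ⟨j, hj⟩ := D.dense.exists_dist_lt y hpos
    obtain ⟨s, hs, hjs⟩ := hR.exists_mem j k
    have hk : 1 ≤ k := (le_max_right i 1).trans (le_max_right _ _)
    have hik : i ≤ s.length := hs ▸ (le_max_left i 1).trans (le_max_right _ _)
    have h0 : s ≠ [] := by rintro rfl; simp at hs; omega
    have h1 := R.dist_le s h0 _ hjs
    rw [hs] at h1
    have h2 := dist_triangle y (D.α j) (D.α (R.c s))
    have h3 := hn k (le_max_left _ _)
    refine ⟨_, ⟨s, Or.inr ⟨hik, ?_⟩, rfl⟩, by linarith⟩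
    by_contra hT
    rw [Bool.not_eq_false] at hT
    refine hy (s.take i) (by simp [hik]) (R.sound _ _ _ hT ?_)
    rw [Metric.mem_closedBall, hs]
    linarith
  · intro hint
    by_contra hne
    obtain ⟨s, his, hs⟩ := hR.exists_subset isOpen_interior (nonempty_iff_ne_empty.2 hne) i
    -- Pass from `U s` to a set `U t` that is disjoint from the given closed set.
    obtain ⟨x, hx, hxA⟩ : ∃ x ∈ S.U s, x ∉ closure A := by
      by_contra hcon
      push Not at hcon
      have : S.U s ⊆ interior (closure A) := interior_maximal hcon (S.isOpen_U s)
      rw [hint] at this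
      exact this (S.mem_c s)
    obtain ⟨q, hq, hxq⟩ := hS.exists_branch hx
    obtain ⟨n, hn⟩ := S.exists_subset_of_mem_nhds hxq (isClosed_closure.isOpen_compl.mem_nhds hxA)
    let k := max n s.length
    let y := D.α (R.c (initSeg q k))
    have hy : y ∈ R.U (initSeg q k) := R.mem_c _
    -- Near the point `y`, only finitely many chosen points fail the test.
    have hyi : y ∈ R.U (initSeg q i) := R.mono_initSeg q (his.trans (le_max_right _ _)) hy
    obtain ⟨δ, hδ, e₀, he⟩ := R.complete _ y hyi
    obtain ⟨t, ht, hyt⟩ := hR.exists_extension hy e₀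
    have hlen : (initSeg q k ++ t).length = k + e₀ := by rw [ht, length_initSeg]
    have htake : (initSeg q k ++ t).take k = initSeg q k := by
      rw [List.take_append_of_le_length (by simp), List.take_of_length_le (by simp)]
    refine hR.not_subset_closure (A := posIndices S R i A) (t := initSeg q k ++ t)
      (N := R.U (initSeg q k ++ t) ∩ Metric.ball y δ)
      ((R.isOpen_U _).inter Metric.isOpen_ball) ⟨y, hyt, Metric.mem_ball_self hδ⟩
      inter_subset_left ?_ ?_
    · rintro s' hs' hlen' ⟨hN1, hN2⟩
      rw [hlen] at hlen'
      have heq : initSeg q k ++ t = s'.take (k + e₀) := by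
        have := hR.eq_take (by rw [hlen]; exact hlen') hN1 (R.mem_c s')
        rwa [hlen] at this
      have hk' : s'.take k = initSeg q k := by
        rw [← htake, heq, List.take_take, min_eq_left (by omega)]
      rcases hs' with ⟨x', hx'A, hx'⟩ | ⟨-, hT⟩
      · have h1 : x' ∈ S.U (initSeg q k) := hk' ▸ S.mono_take s' k hx'
        exact hn k (le_max_left _ _) h1 (subset_closure hx'A)
      · have hi' : s'.take i = initSeg q i := by
          rw [← take_initSeg q (his.trans (le_max_right n s.length)), ← hk', List.take_take,
            min_eq_left (his.trans (le_max_right n s.length))]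
        rw [hi', he _ (by omega) _ (by rw [dist_comm]; exact hN2)] at hT
        exact absurd hT (by simp)
    · refine fun z hz => interior_subset (hs ?_)
      have h1 := R.mono_append _ _ hz.1
      have h2 := R.mono_initSeg q (le_max_right n s.length) h1
      rwa [hq] at h2

theorem exists_transfers_pos [PerfectSpace Y] (hS : S.IsSource) (hR : R.IsTarget) (p : ℕ → ℕ)
    (A : ℕ → TopologicalSpace.Closeds X) (hA : A ∈ (seqRep C.posRep).toFun p) :
    ∃ B ∈ (seqRep D.posRep).toFun (posFun S R p),
      ∀ i, Transfers S R i (A i : Set X) (B i : Set Y) := by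
  choose σ hσ hAσ using fun i => mem_posRep.1 (mem_seqRep.1 hA i)
  refine ⟨fun i => ⟨closure ((fun s => D.α (R.c s)) '' posIndices S R i {x | ∃ n, σ i n = some x}),
    isClosed_closure⟩, mem_seqRep.2 fun i => mem_posRep_posFun (hσ i) rfl, fun i => ?_⟩
  rw [hAσ i]
  exact transfers_pos hS hR i _

/-! ### The reductions -/

/-- All four problems reduce from a space with a source to a perfect space with a
target. -/
theorem strongReducible [PerfectSpace Y] (hS : S.IsSource) (hR : R.IsTarget) :
    StrongReducible C.BCT0 D.BCT0 ∧ StrongReducible C.BCT1 D.BCT1 ∧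
      StrongReducible C.BCT2 D.BCT2 ∧ StrongReducible C.BCT3 D.BCT3 :=
  ⟨strongReducible_avoid hS hR (computableBaire_negFun S R) (exists_transfers_neg hS hR),
    strongReducible_index hS hR (computableBaire_negFun S R) (exists_transfers_neg hS hR),
    strongReducible_avoid hS hR (computableBaire_posFun S R) (exists_transfers_pos hS hR),
    strongReducible_index hS hR (computableBaire_posFun S R) (exists_transfers_pos hS hR)⟩

end System

/-! ### Cylinders in Baire space -/

/-- A point of Baire space as a function. -/
def seqOf (z : SeqSpace ℕ) : ℕ → ℕ := z

theorem seqOf_point (s : List ℕ) :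
    initSeg (seqOf (SeqSpace.point ℕ (Encodable.encode s))) s.length = s := by
  show initSeg (fun i => (listOf (Encodable.encode s)).getD i 0) s.length = s
  rw [listOf_encode, initSeg_getD]

theorem dist_le_iff_initSeg (x y : SeqSpace ℕ) (n : ℕ) :
    dist x y ≤ (1 / 2 : ℝ) ^ n ↔ initSeg (seqOf x) n = initSeg (seqOf y) n :=
  (SeqSpace.dist_le_iff ℕ x y n).trans initSeg_eq_iff.symm

theorem computable_initSeg_point : Computable fun t : List ℕ × ℕ × ℕ =>
    initSeg (seqOf (SeqSpace.point ℕ t.2.1)) t.1.length :=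
  Primrec.to_comp (Primrec.list_map
    (Primrec.list_range.comp (Primrec.list_length.comp Primrec.fst))
    ((Primrec.list_getD 0).comp (Primrec.option_getD.comp
      (Primrec.decode.comp (Primrec.fst.comp (Primrec.snd.comp Primrec.fst)))
      (Primrec.const [])) Primrec.snd))

/-- The cylinders of Baire space. -/
def cylinders : System baire where
  U s := {z | initSeg (seqOf z) s.length = s}
  c s := Encodable.encode s
  T s j e := Nat.ble (s.length + 2) e &&
    decide (initSeg (seqOf (SeqSpace.point ℕ j)) s.length = s)
  computable_c := Computable.encode
  computable_T := computable_and (by fun_prop)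
    (computable_decide_eq computable_initSeg_point Computable.fst)
  mem_c s := seqOf_point s
  mono s n z hz := by
    have hz' : initSeg (seqOf z) (s ++ [n]).length = s ++ [n] := hz
    rw [List.length_append, List.length_singleton, initSeg_succ] at hz'
    exact (List.append_inj hz' (by simp)).1
  dist_le s _ z hz := by
    have hz' : initSeg (seqOf z) s.length = s := hz
    exact (dist_le_iff_initSeg _ _ _).2 (hz'.trans (seqOf_point s).symm)
  sound s j e h z hz := by
    rw [Bool.and_eq_true, Nat.ble_eq, decide_eq_true_eq] at h
    have h1 : dist z (SeqSpace.point ℕ j) ≤ (1 / 2 : ℝ) ^ s.length := by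
      refine (Metric.mem_closedBall.1 hz).trans ?_
      have h2 := half_pow_le h.1
      rw [pow_add] at h2
      linarith
    exact ((dist_le_iff_initSeg _ _ _).1 h1).trans h.2
  complete s z hz := by
    refine ⟨(1 / 2 : ℝ) ^ s.length, by positivity, s.length + 2, fun e he j hj => ?_⟩
    have hz' : initSeg (seqOf z) s.length = s := hz
    have h1 := (dist_le_iff_initSeg z (SeqSpace.point ℕ j) _).1 hj.le
    rw [Bool.and_eq_true, Nat.ble_eq, decide_eq_true_eq]
    exact ⟨he, h1.symm.trans hz'⟩

theorem mem_cylinders {s : List ℕ} {z : SeqSpace ℕ} :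
    z ∈ cylinders.U s ↔ initSeg (seqOf z) s.length = s := Iff.rfl

theorem cylinders_cover (s : List ℕ) (z : SeqSpace ℕ) (hz : z ∈ cylinders.U s) :
    ∃ n, z ∈ cylinders.U (s ++ [n]) := by
  refine ⟨seqOf z s.length, ?_⟩
  rw [mem_cylinders] at hz ⊢
  rw [List.length_append, List.length_singleton, initSeg_succ, hz]

theorem isSource_cylinders : cylinders.IsSource where
  cover := cylinders_cover
  branch q := by
    refine ⟨(q : SeqSpace ℕ), fun k => ?_⟩
    show initSeg q (initSeg q k).length = initSeg q k
    rw [length_initSeg]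

theorem isTarget_cylinders : cylinders.IsTarget where
  root := eq_univ_of_forall fun z => rfl
  disjoint s m n hmn := by
    refine disjoint_left.2 fun z hm hn => hmn ?_
    rw [mem_cylinders] at hm hn
    rw [List.length_append, List.length_singleton] at hm hn
    have := hm.symm.trans hn
    simpa using this
  cover s j h := cylinders_cover s _ h

/-! ### Sequence spaces are perfect and complete -/

instance (E : Type) [TopologicalSpace E] [DiscreteTopology E] : CompleteSpace (SeqSpace E) :=
  PiNat.completeSpace (E := fun _ => E)

instance (E : Type) [TopologicalSpace E] [DiscreteTopology E] [Nontrivial E] :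
    PerfectSpace (SeqSpace E) where
  univ_preperfect x _ := by
    rw [accPt_iff_nhds]
    intro W hW
    obtain ⟨ε, hε, hsub⟩ := Metric.mem_nhds_iff.1 hW
    obtain ⟨n, hn⟩ := exists_half_pow_lt hε
    obtain ⟨a, ha⟩ := exists_ne (x n)
    let y : SeqSpace E := fun i => if i = n then a else x i
    have hy : dist y x ≤ (1 / 2 : ℝ) ^ n := by
      refine (SeqSpace.dist_le_iff E y x n).2 fun i hi => ?_
      simp [y, hi.ne]
    refine ⟨y, ⟨hsub (hy.trans_lt (hn n le_rfl)), trivial⟩, fun h => ha ?_⟩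
    have := congrFun h n
    simpa [y] using this

/-! ### Nested balls in a complete space -/

section Balls

variable {X : Type*} [MetricSpace X] (C : ComputableMetric X)

/-- A criterion for the ball with center `α j` and radius `4 * 2⁻ᵉ` to be contained in the ball
`b = (i, r)` with center `α i` and radius `2⁻ʳ`. -/
def ballTest (b : ℕ × ℕ) (j e : ℕ) : Bool :=
  Nat.ble ((C.approx j b.1 e + 6) * 2 ^ b.2 + 1) (2 ^ e)

theorem computable_ballTest : Computable fun t : (ℕ × ℕ) × ℕ × ℕ =>
    ballTest C t.1 t.2.1 t.2.2 := by
  have h := C.computable_approx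
  unfold ballTest
  fun_prop

theorem ballTest_iff (b : ℕ × ℕ) (j e : ℕ) : ballTest C b j e = true ↔
    (C.approx j b.1 e + 6 : ℝ) * (1 / 2) ^ e < (1 / 2) ^ b.2 := by
  unfold ballTest
  rw [Nat.ble_eq, Nat.add_one_le_iff, ← Nat.cast_lt (α := ℝ)]
  push_cast
  rw [one_div, inv_pow, inv_pow, ← div_eq_mul_inv, div_lt_iff₀ (by positivity), inv_mul_eq_div,
    lt_div_iff₀ (by positivity)]

theorem dist_add_lt_of_ballTest {b : ℕ × ℕ} {j e : ℕ} (h : ballTest C b j e = true) :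
    dist (C.α j) (C.α b.1) + 4 * (1 / 2) ^ e < (1 / 2) ^ b.2 := by
  rw [ballTest_iff] at h
  have h1 := C.le_approx j b.1 e
  have hpow : (1 / 2 : ℝ) ^ e * 2 ^ e = 1 := by rw [← mul_pow]; norm_num
  have hP : (0 : ℝ) < (1 / 2) ^ e := by positivity
  have h2 := mul_le_mul_of_nonneg_left h1 hP.le
  have h3 : (1 / 2 : ℝ) ^ e * (2 ^ e * dist (C.α j) (C.α b.1)) = dist (C.α j) (C.α b.1) := by
    rw [← mul_assoc, hpow, one_mul]
  linarith

theorem ballTest_of_dist {b : ℕ × ℕ} {j e : ℕ}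
    (h : dist (C.α j) (C.α b.1) + 8 * (1 / 2) ^ e < (1 / 2) ^ b.2) : ballTest C b j e = true := by
  rw [ballTest_iff]
  have h1 := C.approx_le j b.1 e
  have hpow : (1 / 2 : ℝ) ^ e * 2 ^ e = 1 := by rw [← mul_pow]; norm_num
  have hP : (0 : ℝ) < (1 / 2) ^ e := by positivity
  have h2 := mul_le_mul_of_nonneg_left h1 hP.le
  have h3 : (1 / 2 : ℝ) ^ e * (2 ^ e * dist (C.α j) (C.α b.1)) = dist (C.α j) (C.α b.1) := by
    rw [← mul_assoc, hpow, one_mul]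
  linarith

theorem exists_ballTest {b : ℕ × ℕ} {x : X} (hx : dist x (C.α b.1) < (1 / 2) ^ b.2) :
    ∃ δ > 0, ∃ e₀, ∀ e ≥ e₀, ∀ j, dist x (C.α j) < δ → ballTest C b j e = true := by
  obtain ⟨e₀, he⟩ := exists_half_pow_lt (ε := ((1 / 2) ^ b.2 - dist x (C.α b.1)) / 16)
    (by linarith)
  refine ⟨((1 / 2) ^ b.2 - dist x (C.α b.1)) / 2, by linarith, e₀, fun e h j hj =>
    ballTest_of_dist C ?_⟩
  have h1 := he e h
  have h2 := dist_triangle_left (C.α j) (C.α b.1) x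
  linarith

/-- The child number `n = ⟨j, e⟩` of the ball `b`: the ball with center `α j` and radius `2⁻ᵉ` if
this is smaller than `b` and seen to be contained in `b`, otherwise the concentric ball of half the
radius. -/
def childBall (b : ℕ × ℕ) (n : ℕ) : ℕ × ℕ :=
  if (Nat.ble (b.2 + 1) n.unpair.2 && ballTest C b n.unpair.1 n.unpair.2) = true then
    (n.unpair.1, n.unpair.2)
  else (b.1, b.2 + 1)

theorem computable_childBall : Computable fun t : (ℕ × ℕ) × ℕ => childBall C t.1 t.2 := by
  have h := computable_ballTest C
  unfold childBall
  fun_prop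

theorem childBall_spec (b : ℕ × ℕ) (n : ℕ) : b.2 + 1 ≤ (childBall C b n).2 ∧
    dist (C.α (childBall C b n).1) (C.α b.1) + (1 / 2) ^ (childBall C b n).2 < (1 / 2) ^ b.2 := by
  unfold childBall
  split_ifs with h
  · rw [Bool.and_eq_true, Nat.ble_eq] at h
    refine ⟨h.1, ?_⟩
    have h1 := dist_add_lt_of_ballTest C h.2
    have hP : (0 : ℝ) < (1 / 2) ^ n.unpair.2 := by positivity
    simp only
    linarith
  · refine ⟨le_rfl, ?_⟩
    have hP : (0 : ℝ) < (1 / 2) ^ b.2 := by positivity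
    simp only [dist_self, pow_succ]
    linarith

/-- The ball with index `s`. -/
def ballAt (s : List ℕ) : ℕ × ℕ := s.foldl (childBall C) (0, 0)

theorem ballAt_append (s : List ℕ) (n : ℕ) :
    ballAt C (s ++ [n]) = childBall C (ballAt C s) n := by
  simp [ballAt]

theorem computable_ballAt : Computable (ballAt C) :=
  computable_foldl (h := fun _ => childBall C) Computable.id (Computable.const (0, 0))
    ((computable_childBall C).comp Computable.snd)

theorem length_le_ballAt (s : List ℕ) : s.length ≤ (ballAt C s).2 := by
  induction s using List.reverseRecOn with
  | nil => simp
  | append_singleton s n ih =>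
    rw [ballAt_append, List.length_append, List.length_singleton]
    exact (Nat.add_le_add_right ih 1).trans (childBall_spec C _ n).1

/-- The system of the balls `ballAt C s`. -/
def balls : System C where
  U s := Metric.ball (C.α (ballAt C s).1) ((1 / 2) ^ (ballAt C s).2)
  c s := (ballAt C s).1
  T s j e := ballTest C (ballAt C s) j e
  computable_c := Computable.fst.comp (computable_ballAt C)
  computable_T := by
    have h1 := computable_ballTest C
    have h2 := computable_ballAt C
    fun_prop
  mem_c s := Metric.mem_ball_self (by positivity)
  mono s n x hx := by
    rw [Metric.mem_ball, ballAt_append] at hx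
    have h1 := (childBall_spec C (ballAt C s) n).2
    have h2 := dist_triangle x (C.α (childBall C (ballAt C s) n).1) (C.α (ballAt C s).1)
    rw [Metric.mem_ball]
    linarith
  dist_le s _ x hx := (Metric.mem_ball.1 hx).le.trans (half_pow_le (length_le_ballAt C s))
  sound s j e h x hx := by
    have h1 := dist_add_lt_of_ballTest C h
    have h2 := dist_triangle x (C.α j) (C.α (ballAt C s).1)
    rw [Metric.mem_closedBall] at hx
    rw [Metric.mem_ball]
    linarith
  complete s x hx := exists_ballTest C hx

theorem isSource_balls [CompleteSpace X] : (balls C).IsSource where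
  cover s x hx := by
    obtain ⟨δ, hδ, e₀, he⟩ := exists_ballTest C (Metric.mem_ball.1 hx)
    let e := max e₀ ((ballAt C s).2 + 1)
    have hpos : (0 : ℝ) < (1 / 2 : ℝ) ^ e := by positivity
    obtain ⟨j, hj⟩ := C.dense.exists_dist_lt x (lt_min hδ hpos)
    have hT := he e (le_max_left _ _) j (hj.trans_le (min_le_left _ _))
    refine ⟨Nat.pair j e, ?_⟩
    have hchild : childBall C (ballAt C s) (Nat.pair j e) = (j, e) := by
      unfold childBall
      simp only [Nat.unpair_pair]
      rw [if_pos]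
      rw [Bool.and_eq_true, Nat.ble_eq]
      exact ⟨le_max_right _ _, hT⟩
    show x ∈ Metric.ball _ _
    rw [ballAt_append, hchild]
    exact hj.trans_le (min_le_right _ _)
  branch q := by
    let u : ℕ → X := fun k => C.α ((balls C).c (initSeg q k))
    have hmem : ∀ {k n}, k ≤ n → u n ∈ (balls C).U (initSeg q k) := fun h =>
      (balls C).mono_initSeg q h ((balls C).mem_c _)
    have hcauchy : CauchySeq u := by
      refine Metric.cauchySeq_iff'.2 fun ε hε => ?_
      obtain ⟨N, hN⟩ := exists_half_pow_lt hε
      refine ⟨N + 1, fun n hn => ?_⟩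
      have h1 := (balls C).dist_le _ (initSeg_ne_nil q (by omega)) _ (hmem hn)
      rw [length_initSeg] at h1
      exact h1.trans_lt (hN _ (by omega))
    obtain ⟨x, hx⟩ := cauchySeq_tendsto_of_complete hcauchy
    refine ⟨x, fun k => ?_⟩
    -- The limit belongs to the closed ball with index `initSeg q (k + 1)`, and this is contained
    -- in the open ball with index `initSeg q k`.
    have h1 : dist x (C.α (ballAt C (initSeg q (k + 1))).1) ≤
        (1 / 2) ^ (ballAt C (initSeg q (k + 1))).2 :=
      le_of_tendsto (hx.dist tendsto_const_nhds) ((eventually_ge_atTop (k + 1)).mono fun n hn =>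
        (Metric.mem_ball.1 (hmem hn)).le)
    rw [initSeg_succ, ballAt_append] at h1
    have h2 := (childBall_spec C (ballAt C (initSeg q k)) (q k)).2
    have h3 := dist_triangle x (C.α (childBall C (ballAt C (initSeg q k)) (q k)).1)
      (C.α (ballAt C (initSeg q k)).1)
    show dist _ _ < _
    linarith

end Balls

/-! ### Generic radii -/

section Split

variable {X : Type*} [MetricSpace X] (C : ComputableMetric X)

/-- Nested intervals `[A k, A k + 1] * 2 ^ -(m + 1 + 2 * k)`, given by their integer left end
points `A k`, that start with `[2 ^ -(m + 1), 2 ^ -m]`. The interval number `k + 1` is the first or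
the last quarter of its predecessor, and chosen so that it does not contain `d (α k, α i)`. -/
def cut (i m k : ℕ) : ℕ :=
  Nat.rec 1 (fun k A => if Nat.ble (16 * A + 8) (C.approx k i (m + 2 * k + 5)) = true
    then 4 * A else 4 * A + 3) k

/-- The decision whether `α k` belongs to the ball with center `α i` and generic radius
`genRadius i m`. -/
def isInside (i m k : ℕ) : Bool :=
  !Nat.ble (16 * cut C i m k + 8) (C.approx k i (m + 2 * k + 5))

theorem cut_succ (i m k : ℕ) : cut C i m (k + 1) =
    if isInside C i m k = true then 4 * cut C i m k + 3 else 4 * cut C i m k := by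
  show (if Nat.ble (16 * cut C i m k + 8) _ = true then _ else _) = _
  unfold isInside
  cases h : Nat.ble (16 * cut C i m k + 8) (C.approx k i (m + 2 * k + 5)) <;> simp [cut]

theorem computable_cut : Computable fun t : ℕ × ℕ × ℕ => cut C t.1 t.2.1 t.2.2 := by
  have h := C.computable_approx
  refine Computable.nat_rec (g := fun _ : ℕ × ℕ × ℕ => 1)
    (h := fun (t : ℕ × ℕ × ℕ) (u : ℕ × ℕ) =>
      if Nat.ble (16 * u.2 + 8) (C.approx u.1 t.1 (t.2.1 + 2 * u.1 + 5)) = true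
        then 4 * u.2 else 4 * u.2 + 3) (by fun_prop) (by fun_prop) ?_
  unfold Computable₂
  fun_prop

theorem computable_isInside : Computable fun t : ℕ × ℕ × ℕ => isInside C t.1 t.2.1 t.2.2 := by
  have h1 := C.computable_approx
  have h2 := computable_cut C
  unfold isInside
  fun_prop

/-- The left end point of an interval of `cut`. -/
def cutLower (i m k : ℕ) : ℝ := cut C i m k * (1 / 2) ^ (m + 1 + 2 * k)

/-- The right end point of an interval of `cut`. -/
def cutUpper (i m k : ℕ) : ℝ := (cut C i m k + 1) * (1 / 2) ^ (m + 1 + 2 * k)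

theorem cutUpper_eq (i m k : ℕ) :
    cutUpper C i m k = cutLower C i m k + (1 / 2) ^ (m + 1 + 2 * k) := by
  unfold cutUpper cutLower
  ring

theorem cut_step (i m k : ℕ) : cutLower C i m k ≤ cutLower C i m (k + 1) ∧
    cutUpper C i m (k + 1) ≤ cutUpper C i m k := by
  have hP : (0 : ℝ) < (1 / 2) ^ (m + 1 + 2 * k) := by positivity
  have he : (1 / 2 : ℝ) ^ (m + 1 + 2 * (k + 1)) = (1 / 2) ^ (m + 1 + 2 * k) / 4 := by
    rw [show m + 1 + 2 * (k + 1) = m + 1 + 2 * k + 2 by ring, pow_add]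
    ring
  unfold cutUpper cutLower
  rw [cut_succ, he]
  split_ifs <;> push_cast <;> constructor <;> nlinarith

/-- The radius `genRadius i m` lies between `2 ^ -(m + 1)` and `2 ^ -m` and differs from all
distances between `α i` and the points `α k`. -/
def genRadius (i m : ℕ) : ℝ := ⨆ k, cutLower C i m k

theorem genRadius_mem (i m k : ℕ) :
    cutLower C i m k ≤ genRadius C i m ∧ genRadius C i m ≤ cutUpper C i m k := by
  have h := Monotone.ciSup_mem_iInter_Icc_of_antitone
    (monotone_nat_of_le_succ fun k => (cut_step C i m k).1)
    (antitone_nat_of_succ_le fun k => (cut_step C i m k).2)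
    (fun k => by rw [cutUpper_eq]; exact le_add_of_nonneg_right (by positivity))
  exact mem_iInter.1 h k

theorem genRadius_pos (i m : ℕ) : 0 < genRadius C i m := by
  refine lt_of_lt_of_le ?_ (genRadius_mem C i m 0).1
  simp [cutLower, cut]

theorem genRadius_le (i m : ℕ) : genRadius C i m ≤ (1 / 2) ^ m := by
  refine (genRadius_mem C i m 0).2.trans (le_of_eq ?_)
  simp only [cutUpper, cut, pow_succ]
  norm_num
  ring

theorem dist_lt_of_isInside {i m k : ℕ} (h : isInside C i m k = true) :
    dist (C.α k) (C.α i) < genRadius C i m := by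
  refine lt_of_lt_of_le ?_ (genRadius_mem C i m (k + 1)).1
  have h1 := C.le_approx k i (m + 2 * k + 5)
  unfold cutLower
  rw [cut_succ, if_pos h]
  have h2 : C.approx k i (m + 2 * k + 5) < 16 * cut C i m k + 8 := by
    unfold isInside at h
    rw [Bool.not_eq_true', ← Bool.not_eq_true, Nat.ble_eq] at h
    omega
  have h3 : (C.approx k i (m + 2 * k + 5) : ℝ) < 16 * cut C i m k + 8 := by exact_mod_cast h2
  have hP : (0 : ℝ) < 2 ^ (m + 2 * k + 3) := by positivity
  rw [show m + 1 + 2 * (k + 1) = m + 2 * k + 3 by ring, one_div, inv_pow, ← div_eq_mul_inv,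
    lt_div_iff₀ hP]
  have h4 : (2 : ℝ) ^ (m + 2 * k + 5) = 4 * 2 ^ (m + 2 * k + 3) := by
    rw [show m + 2 * k + 5 = m + 2 * k + 3 + 2 by ring, pow_add]
    ring
  rw [h4] at h1
  push_cast
  linarith

theorem lt_dist_of_isInside {i m k : ℕ} (h : isInside C i m k = false) :
    genRadius C i m < dist (C.α k) (C.α i) := by
  refine lt_of_le_of_lt (genRadius_mem C i m (k + 1)).2 ?_
  have h1 := C.approx_le k i (m + 2 * k + 5)
  unfold cutUpper
  rw [cut_succ, if_neg (by simp [h])]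
  have h2 : 16 * cut C i m k + 8 ≤ C.approx k i (m + 2 * k + 5) := by
    unfold isInside at h
    rwa [Bool.not_eq_false', Nat.ble_eq] at h
  have h3 : 16 * (cut C i m k : ℝ) + 8 ≤ C.approx k i (m + 2 * k + 5) := by exact_mod_cast h2
  have hP : (0 : ℝ) < 2 ^ (m + 2 * k + 3) := by positivity
  rw [show m + 1 + 2 * (k + 1) = m + 2 * k + 3 by ring, one_div, inv_pow, ← div_eq_mul_inv,
    div_lt_iff₀ hP]
  have h4 : (2 : ℝ) ^ (m + 2 * k + 5) = 4 * 2 ^ (m + 2 * k + 3) := by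
    rw [show m + 2 * k + 5 = m + 2 * k + 3 + 2 by ring, pow_add]
    ring
  rw [h4] at h1
  push_cast
  linarith

theorem isInside_self (i m : ℕ) : isInside C i m i = true := by
  by_contra h
  have := lt_dist_of_isInside C (Bool.eq_false_iff.2 h)
  rw [dist_self] at this
  exact absurd (genRadius_pos C i m) (not_lt.2 this.le)

/-! ### Regions bounded by generic spheres -/

/-- The interior (for `b = true`) or the exterior (for `b = false`) of the sphere with center `α i`
and radius `genRadius i m`, as coded by `(i, m, b)`. -/
def side (l : ℕ × ℕ × Bool) : Set X :=
  {x | if l.2.2 = true then dist x (C.α l.1) < genRadius C l.1 l.2.1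
    else genRadius C l.1 l.2.1 < dist x (C.α l.1)}

theorem mem_side_true {i m : ℕ} {x : X} :
    x ∈ side C (i, m, true) ↔ dist x (C.α i) < genRadius C i m := by
  simp [side]

theorem mem_side_false {i m : ℕ} {x : X} :
    x ∈ side C (i, m, false) ↔ genRadius C i m < dist x (C.α i) := by
  simp [side]

theorem disjoint_side (i m : ℕ) : Disjoint (side C (i, m, true)) (side C (i, m, false)) :=
  disjoint_left.2 fun _ h1 h2 =>
    absurd ((mem_side_true C).1 h1) (not_lt.2 ((mem_side_false C).1 h2).le)

theorem mem_side_iff {l : ℕ × ℕ × Bool} {k : ℕ} :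
    C.α k ∈ side C l ↔ isInside C l.1 l.2.1 k = l.2.2 := by
  obtain ⟨i, m, b⟩ := l
  have h1 := @dist_lt_of_isInside X _ C i m k
  have h2 := @lt_dist_of_isInside X _ C i m k
  cases b
  · rw [mem_side_false]
    refine ⟨fun h => ?_, h2⟩
    by_contra hc
    exact absurd (h1 (Bool.not_eq_false _ ▸ hc)) (not_lt.2 h.le)
  · rw [mem_side_true]
    refine ⟨fun h => ?_, h1⟩
    by_contra hc
    exact absurd (h2 (Bool.not_eq_true _ ▸ hc)) (not_lt.2 h.le)

/-- A sufficient criterion for the ball with center `α j` and radius `4 * 2⁻ᵉ` to be on a given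
side of a sphere. -/
def sideTest (l : ℕ × ℕ × Bool) (j e : ℕ) : Bool :=
  if l.2.2 = true then
    Nat.ble ((C.approx j l.1 e + 6) * 2 ^ (l.2.1 + 1 + e) + 1) (cut C l.1 l.2.1 e)
  else
    Nat.ble (cut C l.1 l.2.1 e + 1 + 6 * 2 ^ (l.2.1 + 1 + e) + 1)
      (C.approx j l.1 e * 2 ^ (l.2.1 + 1 + e))

theorem computable_sideTest : Computable fun t : (ℕ × ℕ × Bool) × ℕ × ℕ =>
    sideTest C t.1 t.2.1 t.2.2 := by
  have h1 := C.computable_approx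
  have h2 := computable_cut C
  unfold sideTest
  fun_prop

theorem sideTest_true_iff {i m j e : ℕ} : sideTest C (i, m, true) j e = true ↔
    (C.approx j i e + 6 : ℝ) * (1 / 2) ^ e < cutLower C i m e := by
  unfold sideTest cutLower
  rw [if_pos rfl, Nat.ble_eq, Nat.add_one_le_iff, ← Nat.cast_lt (α := ℝ),
    show m + 1 + 2 * e = m + 1 + e + e by ring, pow_add _ (m + 1 + e) e, ← mul_assoc,
    mul_lt_mul_iff_left₀ (by positivity), one_div, inv_pow, ← div_eq_mul_inv,
    lt_div_iff₀ (by positivity)]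
  push_cast
  rfl

theorem sideTest_false_iff {i m j e : ℕ} : sideTest C (i, m, false) j e = true ↔
    cutUpper C i m e + 6 * (1 / 2) ^ e < (C.approx j i e : ℝ) * (1 / 2) ^ e := by
  unfold sideTest cutUpper
  rw [if_neg (by simp), Nat.ble_eq, Nat.add_one_le_iff, ← Nat.cast_lt (α := ℝ),
    show m + 1 + 2 * e = m + 1 + e + e by ring, pow_add _ (m + 1 + e) e, ← mul_assoc, ← add_mul,
    mul_lt_mul_iff_left₀ (by positivity), one_div, inv_pow, ← div_eq_mul_inv,
    div_add' _ _ _ (by positivity), div_lt_iff₀ (by positivity)]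
  push_cast
  rfl

theorem approx_mul_bounds (j i e : ℕ) :
    (C.approx j i e : ℝ) * (1 / 2) ^ e ≤ dist (C.α j) (C.α i) + 2 * (1 / 2) ^ e ∧
      dist (C.α j) (C.α i) ≤ (C.approx j i e : ℝ) * (1 / 2) ^ e + 2 * (1 / 2) ^ e := by
  have hpow : (1 / 2 : ℝ) ^ e * 2 ^ e = 1 := by rw [← mul_pow]; norm_num
  have hP : (0 : ℝ) < (1 / 2) ^ e := by positivity
  have h1 := mul_le_mul_of_nonneg_left (C.approx_le j i e) hP.le
  have h2 := mul_le_mul_of_nonneg_left (C.le_approx j i e) hP.le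
  have h3 : (1 / 2 : ℝ) ^ e * (2 ^ e * dist (C.α j) (C.α i)) = dist (C.α j) (C.α i) := by
    rw [← mul_assoc, hpow, one_mul]
  constructor <;> linarith

theorem closedBall_subset_side {l : ℕ × ℕ × Bool} {j e : ℕ} (h : sideTest C l j e = true) :
    Metric.closedBall (C.α j) (4 * (1 / 2) ^ e) ⊆ side C l := by
  obtain ⟨i, m, b⟩ := l
  intro x hx
  rw [Metric.mem_closedBall] at hx
  have h0 := approx_mul_bounds C j i e
  have h1 := genRadius_mem C i m e
  cases b
  · rw [sideTest_false_iff] at h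
    rw [mem_side_false]
    have h2 := dist_triangle_left (C.α j) (C.α i) x
    linarith [h0.1, h0.2, h1.1, h1.2]
  · rw [sideTest_true_iff] at h
    rw [mem_side_true]
    have h2 := dist_triangle x (C.α j) (C.α i)
    linarith [h0.1, h0.2, h1.1, h1.2]

theorem exists_sideTest {l : ℕ × ℕ × Bool} {x : X} (hx : x ∈ side C l) :
    ∃ δ > 0, ∃ e₀, ∀ e ≥ e₀, ∀ j, dist x (C.α j) < δ → sideTest C l j e = true := by
  obtain ⟨i, m, b⟩ := l
  have hη : 0 < |dist x (C.α i) - genRadius C i m| := by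
    rw [abs_pos, sub_ne_zero]
    cases b
    · exact ((mem_side_false C).1 hx).ne'
    · exact ((mem_side_true C).1 hx).ne
  obtain ⟨e₀, he⟩ := exists_half_pow_lt (ε := |dist x (C.α i) - genRadius C i m| / 20)
    (by linarith)
  refine ⟨|dist x (C.α i) - genRadius C i m| / 2, by linarith, e₀, fun e h j hj => ?_⟩
  have h0 := approx_mul_bounds C j i e
  have h1 := genRadius_mem C i m e
  have h2 := he e h
  have h3 : (1 / 2 : ℝ) ^ (m + 1 + 2 * e) ≤ (1 / 2) ^ e := half_pow_le (by omega)
  have h4 := cutUpper_eq C i m e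
  cases b
  · rw [mem_side_false] at hx
    rw [abs_of_pos (by linarith)] at hj h2
    rw [sideTest_false_iff]
    have h5 := dist_triangle x (C.α j) (C.α i)
    linarith [h0.1, h0.2, h1.1, h1.2]
  · rw [mem_side_true] at hx
    rw [abs_of_neg (by linarith)] at hj h2
    rw [sideTest_true_iff]
    have h5 := dist_triangle_left (C.α j) (C.α i) x
    linarith [h0.1, h0.2, h1.1, h1.2]

/-- The intersection of a list of sides. -/
def region (K : List (ℕ × ℕ × Bool)) : Set X := {x | ∀ l ∈ K, x ∈ side C l}

theorem mem_region_cons {l : ℕ × ℕ × Bool} {K : List (ℕ × ℕ × Bool)} {x : X} :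
    x ∈ region C (l :: K) ↔ x ∈ side C l ∧ x ∈ region C K := by
  simp [region]

theorem exists_regionTest {K : List (ℕ × ℕ × Bool)} {x : X} (hx : x ∈ region C K) :
    ∃ δ > 0, ∃ e₀, ∀ e ≥ e₀, ∀ j, dist x (C.α j) < δ →
      (K.all fun l => sideTest C l j e) = true := by
  induction K with
  | nil => exact ⟨1, one_pos, 0, fun e _ j _ => rfl⟩
  | cons l K ih =>
    rw [mem_region_cons] at hx
    obtain ⟨δ, hδ, e₀, he⟩ := ih hx.2
    obtain ⟨δ', hδ', e₀', he'⟩ := exists_sideTest C hx.1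
    refine ⟨min δ δ', lt_min hδ hδ', max e₀ e₀', fun e h j hj => ?_⟩
    rw [List.all_cons, Bool.and_eq_true]
    exact ⟨he' e (le_of_max_le_right h) j (hj.trans_le (min_le_right _ _)),
      he e (le_of_max_le_left h) j (hj.trans_le (min_le_left _ _))⟩

theorem isOpen_side (l : ℕ × ℕ × Bool) : IsOpen (side C l) := by
  obtain ⟨i, m, b⟩ := l
  have hc : Continuous fun x : X => dist x (C.α i) := continuous_id.dist continuous_const
  cases b
  · have h : side C (i, m, false) = {x | genRadius C i m < dist x (C.α i)} :=
      Set.ext fun x => mem_side_false C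
    rw [h]
    exact isOpen_lt continuous_const hc
  · have h : side C (i, m, true) = {x | dist x (C.α i) < genRadius C i m} :=
      Set.ext fun x => mem_side_true C
    rw [h]
    exact isOpen_lt hc continuous_const

theorem isOpen_region (K : List (ℕ × ℕ × Bool)) : IsOpen (region C K) := by
  have h : region C K = ⋂ l ∈ K.toFinset, side C l := by
    ext x
    simp [region]
  rw [h]
  exact isOpen_biInter_finset fun l _ => isOpen_side C l

/-- The decision whether `α j` belongs to a region. -/
def inRegion (K : List (ℕ × ℕ × Bool)) (j : ℕ) : Bool :=
  K.all fun l => decide (isInside C l.1 l.2.1 j = l.2.2)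

theorem inRegion_iff {K : List (ℕ × ℕ × Bool)} {j : ℕ} :
    inRegion C K j = true ↔ C.α j ∈ region C K := by
  simp [inRegion, region, mem_side_iff]

theorem computable_inRegion : Computable fun t : List (ℕ × ℕ × Bool) × ℕ =>
    inRegion C t.1 t.2 := by
  have h := computable_isInside C
  have h1 : Computable fun t : (List (ℕ × ℕ × Bool) × ℕ) × ℕ × ℕ × Bool =>
    decide (isInside C t.2.1 t.2.2.1 t.1.2 = t.2.2.2) := by fun_prop
  unfold inRegion
  exact computable_all Computable.fst h1

/-! ### Splitting a perfect space -/

/-- A state of the splitting process is a region together with the index of one of its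
points. -/
abbrev SplitState : Type := List (ℕ × ℕ × Bool) × ℕ

theorem exists_center (t : SplitState) :
    ∃ j, (!inRegion C t.1 t.2 || inRegion C t.1 j) = true :=
  ⟨t.2, by simp⟩

/-- The index of the first member of the dense sequence in the region; a junk value if the
witness of the state is wrong. -/
def center (t : SplitState) : ℕ := Nat.find (exists_center C t)

theorem center_spec (t : SplitState) :
    (!inRegion C t.1 t.2 || inRegion C t.1 (center C t)) = true :=
  Nat.find_spec (exists_center C t)

variable {C} in
theorem center_mem {t : SplitState} (ht : C.α t.2 ∈ region C t.1) :
    C.α (center C t) ∈ region C t.1 := by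
  have := center_spec C t
  rw [(inRegion_iff C).2 ht, Bool.not_true, Bool.false_or, inRegion_iff] at this
  exact this

variable {C} in
theorem center_le {t : SplitState} {j : ℕ} (hj : C.α j ∈ region C t.1) : center C t ≤ j :=
  Nat.find_min' (exists_center C t) (by simp [(inRegion_iff C).2 hj])

theorem computable_center : Computable (center C) := by
  have h := computable_inRegion C
  have h1 : Computable fun t : SplitState × ℕ =>
    (!inRegion C t.1.1 t.1.2 || inRegion C t.1.1 t.2) := by fun_prop
  exact computable_find (P := fun (t : SplitState) j =>
    !inRegion C t.1 t.2 || inRegion C t.1 j) h1 (exists_center C)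

variable [PerfectSpace X]

/-- As there are no isolated points, a sphere of small generic radius around the center
of a region leaves another point of the region outside. -/
theorem exists_separation (t : SplitState) : ∃ n : ℕ, (!inRegion C t.1 t.2 ||
    (inRegion C t.1 n.unpair.2 &&
      !isInside C (center C t) (n.unpair.1 + t.1.length + 1) n.unpair.2)) = true := by
  by_cases ht : inRegion C t.1 t.2 = true
  · have hc : C.α (center C t) ∈ region C t.1 := by
      have := center_spec C t
      rw [ht, Bool.not_true, Bool.false_or, inRegion_iff] at this
      exact this
    have hinf : (region C t.1).Infinite :=
      infinite_of_mem_nhds _ ((isOpen_region C _).mem_nhds hc)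
    obtain ⟨j, hj, hne⟩ : ∃ j, C.α j ∈ region C t.1 ∧ C.α j ≠ C.α (center C t) := by
      obtain ⟨y, hy, hy'⟩ := hinf.exists_notMem_finite (finite_singleton (C.α (center C t)))
      obtain ⟨j, hj⟩ := C.dense.exists_mem_open
        ((isOpen_region C t.1).inter isClosed_singleton.isOpen_compl) ⟨y, hy, hy'⟩
      exact ⟨j, hj.1, hj.2⟩
    obtain ⟨m, hm⟩ := exists_half_pow_lt (dist_pos.2 hne)
    refine ⟨Nat.pair m j, ?_⟩
    rw [Nat.unpair_pair, (inRegion_iff C).2 hj, Bool.true_and]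
    have : isInside C (center C t) (m + t.1.length + 1) j = false := by
      by_contra hcon
      have h1 := dist_lt_of_isInside C (Bool.not_eq_false _ ▸ hcon)
      have h2 := genRadius_le C (center C t) (m + t.1.length + 1)
      have h3 := hm (m + t.1.length + 1) (by omega)
      linarith
    simp [this]
  · exact ⟨0, by simp [ht]⟩

/-- A code of a radius and of a point of the region outside of the corresponding sphere. -/
def separation (t : SplitState) : ℕ := Nat.find (exists_separation C t)

theorem separation_spec (t : SplitState) : (!inRegion C t.1 t.2 ||
    (inRegion C t.1 (separation C t).unpair.2 && !isInside C (center C t)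
      ((separation C t).unpair.1 + t.1.length + 1) (separation C t).unpair.2)) = true :=
  Nat.find_spec (exists_separation C t)

theorem computable_separation : Computable (separation C) := by
  have h1 := computable_inRegion C
  have h2 := computable_isInside C
  have h3 := computable_center C
  have h4 : Computable fun t : SplitState × ℕ => (!inRegion C t.1.1 t.1.2 ||
    (inRegion C t.1.1 t.2.unpair.2 && !isInside C (center C t.1)
      (t.2.unpair.1 + t.1.1.length + 1) t.2.unpair.2)) := by fun_prop
  exact computable_find (P := fun (t : SplitState) n => !inRegion C t.1 t.2 ||
    (inRegion C t.1 n.unpair.2 && !isInside C (center C t) (n.unpair.1 + t.1.length + 1)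
      n.unpair.2)) h4 (exists_separation C)

/-- The index of the generic radius of the splitting sphere. -/
def splitRadius (t : SplitState) : ℕ := (separation C t).unpair.1 + t.1.length + 1

/-- The part of a region inside of the splitting sphere. -/
def innerState (t : SplitState) : SplitState :=
  ((center C t, splitRadius C t, true) :: t.1, center C t)

/-- The part of a region outside of the splitting sphere. -/
def outerState (t : SplitState) : SplitState :=
  ((center C t, splitRadius C t, false) :: t.1, (separation C t).unpair.2)

/-- The region with index `s`: its `n`-th child is obtained by passing `n` times to the outer
part and then once to the inner part. -/
def splitAt (s : List ℕ) : SplitState :=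
  s.foldl (fun t n => innerState C ((outerState C)^[n] t)) ([], 0)

theorem splitAt_append (s : List ℕ) (n : ℕ) : splitAt C (s ++ [n]) =
    innerState C ((outerState C)^[n] (splitAt C s)) := by
  simp [splitAt]

theorem computable_splitAt : Computable (splitAt C) := by
  have h1 := computable_center C
  have h2 := computable_separation C
  have h3 : Computable (innerState C) := by
    unfold innerState splitRadius
    fun_prop
  have h4 : Computable (outerState C) := by
    unfold outerState splitRadius
    fun_prop
  refine computable_foldl (h := fun _ t n => innerState C ((outerState C)^[n] t))
    Computable.id (Computable.const ([], 0)) (h3.comp ?_)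
  exact computable_iterate (by fun_prop) (by fun_prop) h4

section Valid

variable {C} {t : SplitState} (ht : C.α t.2 ∈ region C t.1)

include ht

theorem innerState_valid : C.α (innerState C t).2 ∈ region C (innerState C t).1 :=
  (mem_region_cons C).2 ⟨(mem_side_iff C).2 (isInside_self C _ _), center_mem ht⟩

theorem outerState_valid : C.α (outerState C t).2 ∈ region C (outerState C t).1 := by
  have := separation_spec C t
  rw [(inRegion_iff C).2 ht, Bool.not_true, Bool.false_or, Bool.and_eq_true, inRegion_iff,
    Bool.not_eq_true'] at this
  exact (mem_region_cons C).2 ⟨(mem_side_iff C).2 this.2, this.1⟩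

theorem iterate_outerState_valid (n : ℕ) :
    C.α ((outerState C)^[n] t).2 ∈ region C ((outerState C)^[n] t).1 := by
  induction n with
  | zero => exact ht
  | succ n ih =>
    rw [Function.iterate_succ_apply']
    exact outerState_valid ih

/-- Every member of the dense sequence in the region belongs to some child, as it otherwise
would remain in the outer parts forever, whose centers have strictly increasing indices. -/
theorem exists_mem_innerState {j : ℕ} (hj : C.α j ∈ region C t.1) :
    ∃ n, C.α j ∈ region C (innerState C ((outerState C)^[n] t)).1 := by
  by_contra hcon
  push Not at hcon
  have hmem : ∀ n, C.α j ∈ region C ((outerState C)^[n] t).1 := by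
    intro n
    induction n with
    | zero => exact hj
    | succ n ih =>
      rw [Function.iterate_succ_apply']
      refine (mem_region_cons C).2 ⟨?_, ih⟩
      rw [mem_side_iff]
      by_contra h
      exact hcon n ((mem_region_cons C).2 ⟨(mem_side_iff C).2 (by simpa using h), ih⟩)
  have hmono : StrictMono fun n => center C ((outerState C)^[n] t) := by
    refine strictMono_nat_of_lt_succ fun n => ?_
    have h1 := center_mem (iterate_outerState_valid ht (n + 1))
    rw [Function.iterate_succ_apply'] at h1
    have h2 := (mem_region_cons C).1 h1
    have h3 := center_le h2.2
    rw [Function.iterate_succ_apply']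
    refine lt_of_le_of_ne h3 fun h => ?_
    have h4 := (mem_side_iff C).1 h2.1
    simp only [← h, isInside_self] at h4
    exact absurd h4 (by simp)
  have h1 : j + 1 ≤ center C ((outerState C)^[j + 1] t) := hmono.le_apply
  have h2 := center_le (hmem (j + 1))
  omega

end Valid

theorem splitAt_valid (s : List ℕ) : C.α (splitAt C s).2 ∈ region C (splitAt C s).1 := by
  induction s using List.reverseRecOn with
  | nil => simp [splitAt, region]
  | append_singleton s n ih =>
    rw [splitAt_append]
    exact innerState_valid (iterate_outerState_valid ih n)

theorem region_iterate_outerState_subset (t : SplitState) {m n : ℕ} (h : m ≤ n) :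
    region C ((outerState C)^[n] t).1 ⊆ region C ((outerState C)^[m] t).1 := by
  induction n, h using Nat.le_induction with
  | base => exact subset_rfl
  | succ n _ ih =>
    rw [Function.iterate_succ_apply']
    exact fun x hx => ih ((mem_region_cons C).1 hx).2

theorem length_le_iterate_outerState (t : SplitState) (n : ℕ) :
    t.1.length ≤ ((outerState C)^[n] t).1.length := by
  induction n with
  | zero => exact le_rfl
  | succ n ih =>
    rw [Function.iterate_succ_apply']
    exact ih.trans (by simp [outerState])

theorem length_le_splitAt (s : List ℕ) : s.length ≤ (splitAt C s).1.length := by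
  induction s using List.reverseRecOn with
  | nil => simp
  | append_singleton s n ih =>
    rw [splitAt_append]
    have := length_le_iterate_outerState C (splitAt C s) n
    simp only [innerState, List.length_append, List.length_cons, List.length_nil]
    omega

/-- The system of the regions `splitAt C s`. -/
def splitSystem : System C where
  U s := region C (splitAt C s).1
  c s := (splitAt C s).2
  T s j e := (splitAt C s).1.all fun l => sideTest C l j e
  computable_c := Computable.snd.comp (computable_splitAt C)
  computable_T := by
    have h1 := computable_sideTest C
    have h2 := computable_splitAt C
    exact computable_all (g := fun (t : List ℕ × ℕ × ℕ) l => sideTest C l t.2.1 t.2.2)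
      (by fun_prop) (by fun_prop)
  mem_c s := splitAt_valid C s
  mono s n x hx := by
    rw [splitAt_append] at hx
    exact region_iterate_outerState_subset C (splitAt C s) (Nat.zero_le n)
      ((mem_region_cons C).1 hx).2
  dist_le s hs x hx := by
    rcases List.eq_nil_or_concat s with rfl | ⟨s, n, rfl⟩
    · exact absurd rfl hs
    · rw [List.concat_eq_append] at hx ⊢
      rw [splitAt_append] at hx ⊢
      have h1 := (mem_side_true C).1 ((mem_region_cons C).1 hx).1
      refine h1.le.trans ((genRadius_le C _ _).trans (half_pow_le ?_))
      have h2 := length_le_iterate_outerState C (splitAt C s) n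
      have h3 := length_le_splitAt C s
      simp only [List.length_append, List.length_cons, List.length_nil, splitRadius]
      omega
  sound s j e h x hx l hl := closedBall_subset_side C (List.all_eq_true.1 h l hl) hx
  complete s x hx := exists_regionTest C hx

theorem isTarget_splitSystem : (splitSystem C).IsTarget where
  root := eq_univ_of_forall fun x l hl => by simp [splitAt] at hl
  disjoint s := by
    have key : ∀ m n, m < n → Disjoint ((splitSystem C).U (s ++ [m]))
        ((splitSystem C).U (s ++ [n])) := by
      intro m n hmn
      refine disjoint_left.2 fun x hm hn => ?_
      have hm' : x ∈ region C (splitAt C (s ++ [m])).1 := hm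
      have hn' : x ∈ region C (splitAt C (s ++ [n])).1 := hn
      rw [splitAt_append] at hm' hn'
      have h1 := region_iterate_outerState_subset C (splitAt C s) (Nat.succ_le_of_lt hmn)
        ((mem_region_cons C).1 hn').2
      rw [Function.iterate_succ_apply'] at h1
      exact disjoint_left.1 (disjoint_side C _ _) ((mem_region_cons C).1 hm').1
        ((mem_region_cons C).1 h1).1
    intro m n hmn
    rcases lt_or_gt_of_ne hmn with h | h
    · exact key m n h
    · exact (key n m h).symm
  cover s j hj := by
    obtain ⟨n, hn⟩ := exists_mem_innerState (splitAt_valid C s) hj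
    refine ⟨n, ?_⟩
    show C.α j ∈ region C (splitAt C (s ++ [n])).1
    rwa [splitAt_append]

end Split

/-! ### The equivalences -/

theorem strongEquiv_baire {X : Type*} [MetricSpace X] [CompleteSpace X] [PerfectSpace X]
    (C : ComputableMetric X) :
    StrongEquiv C.BCT0 baire.BCT0 ∧ StrongEquiv C.BCT1 baire.BCT1 ∧
      StrongEquiv C.BCT2 baire.BCT2 ∧ StrongEquiv C.BCT3 baire.BCT3 := by
  obtain ⟨h0, h1, h2, h3⟩ := System.strongReducible (isSource_balls C) isTarget_cylinders
  obtain ⟨k0, k1, k2, k3⟩ := System.strongReducible isSource_cylinders (isTarget_splitSystem C)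
  exact ⟨⟨h0, k0⟩, ⟨h1, k1⟩, ⟨h2, k2⟩, ⟨h3, k3⟩⟩

end BCat

end

theorem corollary6p6 {X : Type*} [MetricSpace X] [CompleteSpace X] [PerfectSpace X]
    (C : BCat.ComputableMetric X) :
    BCat.StrongEquiv C.BCT0 BCat.baire.BCT0 ∧
    BCat.StrongEquiv C.BCT1 BCat.baire.BCT1 ∧
    BCat.StrongEquiv C.BCT2 BCat.baire.BCT2 ∧
    BCat.StrongEquiv C.BCT3 BCat.baire.BCT3 ∧
    BCat.StrongEquiv BCat.cantor.BCT0 BCat.baire.BCT0 ∧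
    BCat.StrongEquiv BCat.cantor.BCT2 BCat.baire.BCT2 := by
  obtain ⟨h0, h1, h2, h3⟩ := BCat.strongEquiv_baire C
  obtain ⟨k0, -, k2, -⟩ := BCat.strongEquiv_baire BCat.cantor
  exact ⟨h0, h1, h2, h3, k0, k2⟩
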